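/- \textbf{Theorem (Concentration inequality for the relaxed Wasserstein divergence).} Let $d\ge 1$ and let $\|\cdot\|$ be the Euclidean norm of $\mathbb{R}^d$. Let $\phi$ be a real function on a convex set $\mathrm{dom}(\phi)\subset\mathbb{R}^d$ with nonempty interior that is strictly convex and twice differentiable with an $L$-Lipschitz continuous gradient there, $L>0$, and let $D_\phi(x,y)=\phi(x)-\phi(y)-\langle\nabla\phi(y),x-y\rangle$ be its Bregman divergence. For probability measures $\mathbb{P},\mathbb{Q}$ on a Borel set $\mathcal{X}\subset\mathrm{dom}(\phi)$ put $$W_{D_\phi}(\mathbb{P},\mathbb{Q})=\inf_{\pi\in\Pi(\mathbb{P},\mathbb{Q})}\int D_\phi(x,y)\,\pi(dx,dy)\in[0,\infty],$$ where $\Pi(\mathbb{P},\mathbb{Q})$ is the set of couplings of $\mathbb{P}$ and $\mathbb{Q}$. Let $\mathbb{P}_r$ be a probability measure on $\mathcal{X}$, and let $\mathbb{P}_n=\frac1n\sum_{i=1}^n\delta_{X_i}$ be the empirical measure of $n$ independent observations $X_1,\dots,X_n$ with law $\mathbb{P}_r$. Write $M_q(\mathbb{P}_r)=\int\|x\|^q\,\mathbb{P}_r(dx)$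 and $\mathcal{E}_{\alpha,\gamma}(\mathbb{P}_r)=\int\exp(\gamma\|x\|^\alpha)\,\mathbb{P}_r(dx)$. Assume one of the following: \begin{enumerate} \item[(1)] $\mathcal{E}_{\alpha,\gamma}(\mathbb{P}_r)<\infty$ for some $\alpha>2$, $\gamma>0$; \item[(2)] $\mathcal{E}_{\alpha,\gamma}(\mathbb{P}_r)<\infty$ for some $\alpha\in(0,2)$, $\gamma>0$; in this case let $\eta\in(0,\alpha)$ be arbitrary; \item[(3)] $M_q(\mathbb{P}_r)<\infty$ for some $q>4$; in this case let $\eta\in(0,q)$ be arbitrary. \end{enumerate} Then there are constants $c,C_1,C_2>0$ such that for all $n\ge1$ and all $\epsilon>0$ $$\mathrm{Prob}\bigl(W_{D_\phi}(\mathbb{P}_n,\mathbb{P}_r)\ge\epsilon\bigr)\le a(n,\epsilon)\,1_{\{\epsilon\le L/2\}}+b(n,\epsilon),$$ where $$a(n,\epsilon)=C_1\begin{cases}\exp\left(-\frac{4cn\epsilon^2}{L^2}\right),&1\le d\le3,\\[2pt] \exp\left(-\frac{4cn\epsilon^2}{L^2\log^2\left(2+\frac{L}{2\epsilon}\right)}\right),&d=4,\\[2pt]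 \exp\left(-cn\left(\frac{2\epsilon}{L}\right)^{d/2}\right),&d\ge5,\end{cases}$$ and $$b(n,\epsilon)=C_2\begin{cases}\exp\left(-cn\left(\frac{2\epsilon}{L}\right)^{\alpha/2}\right)1_{\{\epsilon>L/2\}},&\text{under (1)},\\[2pt] \exp\left(-c\left(\frac{2n\epsilon}{L}\right)^{(\alpha-\eta)/2}\right)1_{\{\epsilon\le L/2\}}+\exp\left(-c\left(\frac{2n\epsilon}{L}\right)^{\alpha/2}\right)1_{\{\epsilon>L/2\}},&\text{under (2)},\\[2pt] n\left(\frac{2n\epsilon}{L}\right)^{-(q-\eta)/2},&\text{under (3)}.\end{cases}$$ The constants depend only on $d$ and on: $\alpha$, $\gamma$ and an upper bound for $\mathcal{E}_{\alpha,\gamma}(\mathbb{P}_r)$ under (1); $\alpha$, $\gamma$, $\eta$ and an upper bound for $\mathcal{E}_{\alpha,\gamma}(\mathbb{P}_r)$ under (2); $q$, $\eta$ and an upper bound for $M_q(\mathbb{P}_r)$ under (3). In particular they do not depend on $n$, $\epsilon$, $\phi$, $L$ or $\mathcal{X}$. -/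

import Mathlib

open MeasureTheory ProbabilityTheory
open scoped NNReal ENNReal

namespace RelaxedWasserstein

/-- Euclidean space `ℝ^d` with the norm `‖·‖₂`. -/
abbrev Space (d : ℕ) : Type := EuclideanSpace ℝ (Fin d)

/-- `φ` is a strictly convex, twice differentiable function on its (convex, full-dimensional)
domain `dom`, with an `L`-Lipschitz continuous gradient there. The gradient is taken within `dom`,
so that `dom` need be neither open nor closed; at interior points it is the usual gradient. -/
structure IsSmoothStrictlyConvex {d : ℕ} (dom : Set (Space d)) (φ : Space d → ℝ) (L : ℝ) :
    Prop where
  interior_nonempty : (interior dom).Nonempty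
  /-- This includes convexity of `dom`. -/
  strictConvexOn : StrictConvexOn ℝ dom φ
  differentiableOn : DifferentiableOn ℝ φ dom
  differentiableOn_gradient : DifferentiableOn ℝ (gradientWithin φ dom) dom
  lipschitz_gradient : ∀ x ∈ dom, ∀ y ∈ dom,
    ‖gradientWithin φ dom x - gradientWithin φ dom y‖ ≤ L * ‖x - y‖

/-- The Bregman divergence `D_φ(x, y) = φ(x) - φ(y) - ⟨∇φ(y), x - y⟩`. -/
noncomputable def bregman {d : ℕ} (dom : Set (Space d)) (φ : Space d → ℝ) (x y : Space d) : ℝ :=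
  φ x - φ y - inner ℝ (gradientWithin φ dom y) (x - y)

/-- The set `Π(P, Q)` of couplings of `P` and `Q`. -/
def couplings {d : ℕ} (P Q : Measure (Space d)) : Set (Measure (Space d × Space d)) :=
  {π | π.map Prod.fst = P ∧ π.map Prod.snd = Q}

/-- The relaxed Wasserstein divergence
`W_{D_φ}(P, Q) = inf_{π ∈ Π(P, Q)} ∫ D_φ(x, y) π(dx, dy)`, with values in `[0, ∞]`.
For `P` and `Q` concentrated on `dom` the integrand is nonnegative almost everywhere. -/
noncomputable def rwDivergence {d : ℕ} (dom : Set (Space d)) (φ : Space d → ℝ)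
    (P Q : Measure (Space d)) : ℝ≥0∞ :=
  ⨅ π ∈ couplings P Q, ∫⁻ z, ENNReal.ofReal (bregman dom φ z.1 z.2) ∂π

/-- The empirical distribution `(1/n) ∑ δ_{x_i}` of `n` points. -/
noncomputable def empiricalMeasure {d n : ℕ} (x : Fin n → Space d) : Measure (Space d) :=
  (n : ℝ≥0∞)⁻¹ • ∑ i, Measure.dirac (x i)

/-- The moment `M_q(P) = ∫ ‖x‖^q P(dx)`. -/
noncomputable def powerMoment {d : ℕ} (q : ℝ) (P : Measure (Space d)) : ℝ≥0∞ :=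
  ∫⁻ x, ENNReal.ofReal (‖x‖ ^ q) ∂P

/-- The exponential moment `E_{α,γ}(P) = ∫ exp(γ ‖x‖^α) P(dx)`. -/
noncomputable def expMoment {d : ℕ} (α γ : ℝ) (P : Measure (Space d)) : ℝ≥0∞ :=
  ∫⁻ x, ENNReal.ofReal (Real.exp (γ * ‖x‖ ^ α)) ∂P

/-- The three alternative moment conditions, with their parameters; in the last two cases `η` is
the arbitrarily small loss in the exponent of the resulting bound. -/
inductive MomentCondition where
  /-- `E_{α,γ}(P) < ∞` with `α > 2`, `γ > 0`. -/
  | expHigh (α γ : ℝ)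
  /-- `E_{α,γ}(P) < ∞` with `0 < α < 2`, `γ > 0`, and `0 < η < α`. -/
  | expLow (α γ η : ℝ)
  /-- `M_q(P) < ∞` with `q > 4`, and `0 < η < q`. -/
  | power (q η : ℝ)

/-- The admissible range of the parameters. -/
def MomentCondition.Valid : MomentCondition → Prop
  | .expHigh α γ => 2 < α ∧ 0 < γ
  | .expLow α γ η => 0 < α ∧ α < 2 ∧ 0 < γ ∧ 0 < η ∧ η < α
  | .power q η => 4 < q ∧ 0 < η ∧ η < q

/-- The moment that is required to be finite. -/
noncomputable def MomentCondition.moment {d : ℕ} :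
    MomentCondition → Measure (Space d) → ℝ≥0∞
  | .expHigh α γ, P => expMoment α γ P
  | .expLow α γ _, P => expMoment α γ P
  | .power q _, P => powerMoment q P

/-- The function `a(n, ε)` (used for `d ≥ 1`). -/
noncomputable def boundA (d : ℕ) (c C₁ L : ℝ) (n : ℕ) (ε : ℝ) : ℝ :=
  C₁ *
    if d ≤ 3 then Real.exp (-(4 * c * n * ε ^ 2 / L ^ 2))
    else if d = 4 then
      Real.exp (-(4 * c * n * ε ^ 2 / (L ^ 2 * Real.log (2 + L / (2 * ε)) ^ 2)))
    else Real.exp (-(c * n * (2 * ε / L) ^ ((d : ℝ) / 2)))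

/-- The function `b(n, ε)`. -/
noncomputable def boundB (c C₂ L : ℝ) (n : ℕ) (ε : ℝ) : MomentCondition → ℝ
  | .expHigh α _ =>
      C₂ * if L / 2 < ε then Real.exp (-(c * n * (2 * ε / L) ^ (α / 2))) else 0
  | .expLow α _ η =>
      C₂ * ((if ε ≤ L / 2 then Real.exp (-(c * (2 * n * ε / L) ^ ((α - η) / 2))) else 0) +
        (if L / 2 < ε then Real.exp (-(c * (2 * n * ε / L) ^ (α / 2))) else 0))
  | .power q η => C₂ * (n * (2 * n * ε / L) ^ (-((q - η) / 2)))

end RelaxedWasserstein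

namespace RelaxedWasserstein

/-! Along a segment the Lipschitz gradient gives `D_φ(x, y) ≤ (L/2) ‖x - y‖²` (`bregman_le`), so the
divergence is at most `L/2` times the quadratic transport cost. It suffices to bound the probability
that this cost reaches `x = 2ε/L`, and `φ`, `L` and the domain disappear from the problem.

The quadratic cost is bounded through an explicit transport plan. Space is cut into dyadic shells,
and each shell into nested dyadic cells. As much mass as possible is matched within the finest
cells, the leftover within the next coarser cells, and so on. A move at scale `j` in shell `k` costs
a multiple of `4^(k-j)`, and, except at the finest scale, the mass moved is at most the deviation of
the empirical measure over the cells of scale `j+1`. This gives `quadCost_le`: weighted cell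
deviations of the first `M` shells, a truncation error for the finest scale, and second moments
outside these shells.

The total deviation over finitely many cells is a maximum of empirical means over sign patterns, so
a Bernstein bound and a union bound control it (`IsSample.cellDev_le`). In a shell of mass `p` the
fluctuation at scale `j` is of order `√(p 2^(dj) / N)`. The series `∑ 2^(dj/2) 4^(-j)` converges for
`d ≤ 3`, has constant terms for `d = 4`, and is dominated by its last term for `d ≥ 5`. These are
the three regimes of `rate` (`exists_scale`). Shell masses decay like `2^(-qk)` with `q > 4`, which
leaves room for a geometric factor both in the errors, which become summable over the shells, and in
the exponents, which grow with the shell (`exists_quadCost_concentration`).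

What remains is the deviation of `∑ ‖X_i‖²` over far observations. The number `M` of shells is
chosen so that the mean of this tail is a small fraction of `x` (`exists_quadCost_le_tail`). Its
upper deviations come from Chernoff's inequality: directly, or after Jensen's inequality, if `α >
2`; after truncation, with a union bound for the largest observation, if `α < 2` or only a power
moment is finite. -/

/-! ### Comparison with the quadratic transport cost -/

/-- The optimal transport cost between `P` and `Q` for the squared Euclidean distance. -/
noncomputable def quadCost {d : ℕ} (P Q : Measure (Space d)) : ℝ≥0∞ :=
  ⨅ π ∈ couplings P Q, ∫⁻ z, ENNReal.ofReal (‖z.1 - z.2‖ ^ 2) ∂π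

/-- The descent lemma. On the segment from `y` to `x` the derivative of `φ` exceeds its value at `y`
by at most `L t ‖x - y‖²`. Comparing one-sided derivatives with those of a quadratic polynomial in
`t` works up to the boundary of `dom`. -/
theorem bregman_le {d : ℕ} {dom : Set (Space d)} {φ : Space d → ℝ} {L : ℝ}
    (h : IsSmoothStrictlyConvex dom φ L) {x y : Space d} (hx : x ∈ dom) (hy : y ∈ dom) :
    bregman dom φ x y ≤ L / 2 * ‖x - y‖ ^ 2 := by
  have hconv : Convex ℝ dom := h.strictConvexOn.1
  have hmem : ∀ t ∈ Set.Icc (0 : ℝ) 1, y + t • (x - y) ∈ dom := fun t ht =>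
    hconv.add_smul_sub_mem hy hx ht
  set G : Space d → Space d := gradientWithin φ dom with hG
  have hder : ∀ t ∈ Set.Icc (0 : ℝ) 1,
      HasDerivWithinAt (fun t : ℝ => φ (y + t • (x - y)))
        (inner ℝ (G (y + t • (x - y))) (x - y)) (Set.Icc 0 1) t := by
    intro t ht
    have h1 := (h.differentiableOn _ (hmem t ht)).hasGradientWithinAt
    have h2 : HasDerivWithinAt (fun t : ℝ => y + t • (x - y)) (x - y) (Set.Icc 0 1) t := by
      have := ((hasDerivAt_id t).smul_const (x - y)).const_add y
      simpa using this.hasDerivWithinAt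
    have h3 := h1.hasFDerivWithinAt.comp_hasDerivWithinAt t h2 (fun s hs => hmem s hs)
    exact h3
  have key := image_le_of_deriv_right_le_deriv_boundary (a := 0) (b := 1)
    (f := fun t : ℝ => φ (y + t • (x - y)))
    (f' := fun t => inner ℝ (G (y + t • (x - y))) (x - y))
    (fun t ht => (hder t ht).continuousWithinAt)
    (fun t ht => ((hder t (Set.Ico_subset_Icc_self ht)).mono_of_mem_nhdsWithin
      (Icc_mem_nhdsGE_of_mem ht)))
    (B := fun t => φ y + t * inner ℝ (G y) (x - y) + L / 2 * t ^ 2 * ‖x - y‖ ^ 2)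
    (B' := fun t => inner ℝ (G y) (x - y) + L * t * ‖x - y‖ ^ 2)
    (by simp) (by fun_prop)
    (fun t _ => by
      have h1 : HasDerivAt (fun t : ℝ => φ y + t * inner ℝ (G y) (x - y) +
          L / 2 * t ^ 2 * ‖x - y‖ ^ 2)
          (1 * inner ℝ (G y) (x - y) + L / 2 * ((2 : ℕ) * t ^ (2 - 1)) * ‖x - y‖ ^ 2) t :=
        (((hasDerivAt_id t).mul_const _).const_add _).add
          (((hasDerivAt_pow 2 t).const_mul _).mul_const _)
      refine HasDerivAt.hasDerivWithinAt (h1.congr_deriv ?_)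
      push_cast
      ring)
    (fun t ht => by
      have h1 := h.lipschitz_gradient _ (hmem t (Set.Ico_subset_Icc_self ht)) y hy
      have h2 : inner ℝ (G (y + t • (x - y)) - G y) (x - y) ≤ L * t * ‖x - y‖ ^ 2 := by
        refine (real_inner_le_norm _ _).trans ?_
        have h3 : ‖y + t • (x - y) - y‖ = t * ‖x - y‖ := by
          rw [add_sub_cancel_left, norm_smul, Real.norm_of_nonneg ht.1]
        rw [h3] at h1
        calc _ ≤ L * (t * ‖x - y‖) * ‖x - y‖ :=
              mul_le_mul_of_nonneg_right h1 (norm_nonneg _)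
          _ = _ := by ring
      rw [inner_sub_left] at h2
      linarith)
  have h1 := key (Set.right_mem_Icc.2 zero_le_one)
  simp only [one_smul, add_sub_cancel] at h1
  rw [bregman]
  linarith

/-- Every coupling has its marginals on `X`, so both coordinates lie in `dom` almost surely and
`bregman_le` can be integrated. -/
theorem rwDivergence_le {d : ℕ} {dom X : Set (Space d)} {φ : Space d → ℝ} {L : ℝ} (hL : 0 < L)
    (h : IsSmoothStrictlyConvex dom φ L) (hX : MeasurableSet X) (hXdom : X ⊆ dom)
    {P Q : Measure (Space d)} (hP : P Xᶜ = 0) (hQ : Q Xᶜ = 0) :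
    rwDivergence dom φ P Q ≤ ENNReal.ofReal (L / 2) * quadCost P Q := by
  have hL2 : ENNReal.ofReal (L / 2) ≠ 0 := by simpa using half_pos hL
  simp only [rwDivergence, quadCost, ENNReal.mul_iInf_of_ne hL2 ENNReal.ofReal_ne_top]
  refine iInf₂_mono fun π hπ => ?_
  rw [← lintegral_const_mul' _ _ ENNReal.ofReal_ne_top]
  have h1 : ∀ᵐ z ∂π, z.1 ∈ X := by
    rw [ae_iff, ← hP, ← hπ.1, Measure.map_apply measurable_fst hX.compl]
    rfl
  have h2 : ∀ᵐ z ∂π, z.2 ∈ X := by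
    rw [ae_iff, ← hQ, ← hπ.2, Measure.map_apply measurable_snd hX.compl]
    rfl
  refine lintegral_mono_ae ?_
  filter_upwards [h1, h2] with z hz1 hz2
  rw [← ENNReal.ofReal_mul (half_pos hL).le]
  exact ENNReal.ofReal_le_ofReal (bregman_le h (hXdom hz1) (hXdom hz2))

/-! ### Partial couplings and hierarchical transport -/

section Coupling

variable {E : Type*} [MeasurableSpace E]

/-- `π` transports part of `μ` to part of `ν`; what is not transported is `μ'` and `ν'`. -/
structure IsPartialCoupling (μ ν : Measure E) (π : Measure (E × E)) (μ' ν' : Measure E) :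
    Prop where
  fst : π.map Prod.fst + μ' = μ
  snd : π.map Prod.snd + ν' = ν

namespace IsPartialCoupling

variable {μ ν : Measure E} {π : Measure (E × E)} {μ' ν' : Measure E}

theorem left_le (h : IsPartialCoupling μ ν π μ' ν') : μ' ≤ μ :=
  h.fst ▸ Measure.le_add_left le_rfl

theorem right_le (h : IsPartialCoupling μ ν π μ' ν') : ν' ≤ ν :=
  h.snd ▸ Measure.le_add_left le_rfl

theorem univ_le_left (h : IsPartialCoupling μ ν π μ' ν') : π Set.univ ≤ μ Set.univ := by
  rw [← h.fst, Measure.add_apply, Measure.map_apply measurable_fst .univ, Set.preimage_univ]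
  exact le_self_add

theorem univ_le_right (h : IsPartialCoupling μ ν π μ' ν') : π Set.univ ≤ ν Set.univ := by
  rw [← h.snd, Measure.add_apply, Measure.map_apply measurable_snd .univ, Set.preimage_univ]
  exact le_self_add

theorem zero (μ ν : Measure E) : IsPartialCoupling μ ν 0 μ ν := ⟨by simp, by simp⟩

theorem trans (h : IsPartialCoupling μ ν π μ' ν') {π₂ : Measure (E × E)} {μ'' ν'' : Measure E}
    (h₂ : IsPartialCoupling μ' ν' π₂ μ'' ν'') : IsPartialCoupling μ ν (π + π₂) μ'' ν'' := by
  constructor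
  · rw [Measure.map_add _ _ measurable_fst, add_assoc, h₂.fst, h.fst]
  · rw [Measure.map_add _ _ measurable_snd, add_assoc, h₂.snd, h.snd]

theorem sum {ι : Type*} {μ ν : ι → Measure E} {π : ι → Measure (E × E)}
    {μ' ν' : ι → Measure E} (h : ∀ k, IsPartialCoupling (μ k) (ν k) (π k) (μ' k) (ν' k)) :
    IsPartialCoupling (Measure.sum μ) (Measure.sum ν) (Measure.sum π) (Measure.sum μ')
      (Measure.sum ν') := by
  constructor
  · rw [Measure.map_sum measurable_fst.aemeasurable, Measure.sum_add_sum]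
    simp only [(h _).fst]
  · rw [Measure.map_sum measurable_snd.aemeasurable, Measure.sum_add_sum]
    simp only [(h _).snd]

/-- The mass of a set is balanced if `π` does not move mass across its boundary. -/
theorem balance (h : IsPartialCoupling μ ν π μ' ν') {A : Set E} (hA : MeasurableSet A)
    (hπ : ∀ᵐ z ∂π, z.1 ∈ A ↔ z.2 ∈ A) : μ' A + ν A = ν' A + μ A := by
  have h1 : π.map Prod.fst A = π.map Prod.snd A := by
    rw [Measure.map_apply measurable_fst hA, Measure.map_apply measurable_snd hA]
    refine measure_congr ?_
    filter_upwards [hπ] with z hz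
    exact propext hz
  rw [← h.fst, ← h.snd, Measure.add_apply, Measure.add_apply, h1]
  ac_rfl

/-- By `balance` the two leftovers on `A` differ by exactly `μ A - ν A`. If one of them vanishes,
the other is the absolute value of this difference. -/
theorem left_le_abs (h : IsPartialCoupling μ ν π μ' ν') [IsFiniteMeasure μ] [IsFiniteMeasure ν]
    {A : Set E} (hA : MeasurableSet A) (hπ : ∀ᵐ z ∂π, z.1 ∈ A ↔ z.2 ∈ A)
    (h0 : μ' A = 0 ∨ ν' A = 0) :
    μ' A ≤ ENNReal.ofReal |μ.real A - ν.real A| ∧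
      ν' A ≤ ENNReal.ofReal |μ.real A - ν.real A| := by
  have hb := h.balance hA hπ
  have hμ' : μ' A ≠ ∞ := ((h.left_le A).trans_lt (measure_lt_top μ A)).ne
  have hν' : ν' A ≠ ∞ := ((h.right_le A).trans_lt (measure_lt_top ν A)).ne
  have hr : (μ' A).toReal + ν.real A = (ν' A).toReal + μ.real A := by
    rw [Measure.real, Measure.real, ← ENNReal.toReal_add hμ' (measure_ne_top _ _),
      ← ENNReal.toReal_add hν' (measure_ne_top _ _), hb]
  have e1 : (μ' A).toReal = 0 ∨ (ν' A).toReal = 0 := by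
    rcases h0 with h0 | h0 <;> simp [h0]
  have p1 : 0 ≤ (μ' A).toReal := ENNReal.toReal_nonneg
  have p2 : 0 ≤ (ν' A).toReal := ENNReal.toReal_nonneg
  have a1 := le_abs_self (μ.real A - ν.real A)
  have a2 := neg_abs_le (μ.real A - ν.real A)
  constructor
  · rw [← ENNReal.ofReal_toReal hμ']
    refine ENNReal.ofReal_le_ofReal ?_
    rcases e1 with e | e <;> linarith
  · rw [← ENNReal.ofReal_toReal hν']
    refine ENNReal.ofReal_le_ofReal ?_
    rcases e1 with e | e <;> linarith

end IsPartialCoupling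

/-- Product couplings transport as much mass as possible. -/
theorem exists_partialCoupling_prod (μ ν : Measure E) [IsFiniteMeasure μ] [IsFiniteMeasure ν] :
    ∃ (a : ℝ≥0∞) (μ' ν' : Measure E), IsPartialCoupling μ ν (a • μ.prod ν) μ' ν' ∧
      (μ' Set.univ = 0 ∨ ν' Set.univ = 0) ∧ a * ν Set.univ ≤ 1 ∧ a * μ Set.univ ≤ 1 := by
  set u := μ Set.univ with hu
  set v := ν Set.univ with hv
  have hu' : u ≠ ∞ := measure_ne_top _ _
  have hv' : v ≠ ∞ := measure_ne_top _ _
  -- The normalised product transports mass `min u v`. If both masses vanish then `a = ∞`, which is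
  -- harmless because `∞ * 0 = 0`.
  set a := (max u v)⁻¹ with ha
  have hav : a * v ≤ 1 := (mul_le_mul_right (le_max_right u v) a).trans (ENNReal.inv_mul_le_one _)
  have hau : a * u ≤ 1 := (mul_le_mul_right (le_max_left u v) a).trans (ENNReal.inv_mul_le_one _)
  refine ⟨a, (1 - a * v) • μ, (1 - a * u) • ν, ⟨?_, ?_⟩, ?_, hav, hau⟩
  · rw [Measure.map_smul, Measure.map_fst_prod, smul_smul, ← add_smul,
      add_tsub_cancel_of_le hav, one_smul]
  · rw [Measure.map_smul, Measure.map_snd_prod, smul_smul, ← add_smul,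
      add_tsub_cancel_of_le hau, one_smul]
  · simp only [Measure.smul_apply, smul_eq_mul, ← hu, ← hv]
    rcases le_total u v with h | h
    · left
      rcases eq_or_ne v 0 with h0 | h0
      · have : u = 0 := le_zero_iff.1 (h0 ▸ h)
        simp [this]
      · rw [ha, max_eq_right h, ENNReal.inv_mul_cancel h0 hv']
        simp
    · right
      rcases eq_or_ne u 0 with h0 | h0
      · have : v = 0 := le_zero_iff.1 (h0 ▸ h)
        simp [this]
      · rw [ha, max_eq_left h, ENNReal.inv_mul_cancel h0 hu']
        simp

variable {ι : Type*} [Countable ι] [MeasurableSpace ι] [MeasurableSingletonClass ι]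

theorem sum_restrict_fiber (μ : Measure E) {g : E → ι} (hg : Measurable g) :
    Measure.sum (fun k => μ.restrict (g ⁻¹' {k})) = μ := by
  rw [← Measure.restrict_iUnion (fun i j hij => Disjoint.preimage g (by simpa using hij))
    (fun k => hg (measurableSet_singleton k)), ← Set.preimage_iUnion, Set.iUnion_of_singleton, Set.preimage_univ, Measure.restrict_univ]

theorem tsum_measure_fiber (μ : Measure E) {g : E → ι} (hg : Measurable g) :
    ∑' k, μ (g ⁻¹' {k}) = μ Set.univ := by
  conv_rhs => rw [← sum_restrict_fiber μ hg, Measure.sum_apply _ .univ]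
  simp

/-- Transport within the fibers of `g`, as much as possible. -/
theorem exists_partialCoupling_fiber (μ ν : Measure E) [IsFiniteMeasure μ] [IsFiniteMeasure ν]
    {g : E → ι} (hg : Measurable g) :
    ∃ (π : Measure (E × E)) (μ' ν' : Measure E), IsPartialCoupling μ ν π μ' ν' ∧
      (∀ k, μ' (g ⁻¹' {k}) = 0 ∨ ν' (g ⁻¹' {k}) = 0) ∧ ∀ᵐ z ∂π, g z.1 = g z.2 := by
  have hgk : ∀ k, MeasurableSet (g ⁻¹' {k}) := fun k => hg (measurableSet_singleton k)
  choose a μ' ν' h h0 hav hau using fun k =>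
    exists_partialCoupling_prod (μ.restrict (g ⁻¹' {k})) (ν.restrict (g ⁻¹' {k}))
  have hsum := IsPartialCoupling.sum h
  rw [sum_restrict_fiber μ hg, sum_restrict_fiber ν hg] at hsum
  refine ⟨_, _, _, hsum, fun k => ?_, ?_⟩
  -- The leftover of the sum on fiber `k` comes from the `k`-th piece alone, since the other pieces
  -- live on disjoint fibers.
  · have aux : ∀ (m m' : ι → Measure E), (∀ j, m' j ≤ (m j).restrict (g ⁻¹' {j})) →
        m' k Set.univ = 0 → Measure.sum m' (g ⁻¹' {k}) = 0 := by
      intro m m' hm hk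
      rw [Measure.sum_apply _ (hgk k), ENNReal.tsum_eq_zero]
      intro j
      by_cases hj : j = k
      · subst hj
        exact measure_mono_null (Set.subset_univ _) hk
      · refine le_zero_iff.1 ((hm j _).trans ?_)
        rw [Measure.restrict_apply (hgk k)]
        have : g ⁻¹' {k} ∩ g ⁻¹' {j} = ∅ := by
          ext x
          simp only [Set.mem_inter_iff, Set.mem_preimage, Set.mem_singleton_iff,
            Set.mem_empty_iff_false, iff_false, not_and]
          rintro h1 h2
          exact hj (h2.symm.trans h1)
        simp [this]
    rcases h0 k with h1 | h1
    · exact Or.inl (aux (fun _ => μ) _ (fun j => (h j).left_le) h1)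
    · exact Or.inr (aux (fun _ => ν) _ (fun j => (h j).right_le) h1)
  · rw [Measure.ae_sum_iff]
    intro k
    refine Measure.ae_smul_measure ?_ _
    have e1 : ∀ᵐ z ∂(μ.restrict (g ⁻¹' {k})).prod (ν.restrict (g ⁻¹' {k})),
        z ∈ (g ⁻¹' {k}) ×ˢ (g ⁻¹' {k}) := by
      rw [Measure.prod_restrict]
      exact ae_restrict_mem ((hgk k).prod (hgk k))
    filter_upwards [e1] with z hz
    exact hz.1.trans hz.2.symm

/-- The total deviation of `μ` from `ν` over the fibers of `g`. -/
noncomputable def fiberDev (μ ν : Measure E) (g : E → ι) : ℝ≥0∞ :=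
  ∑' k, ENNReal.ofReal |μ.real (g ⁻¹' {k}) - ν.real (g ⁻¹' {k})|

theorem IsPartialCoupling.univ_le_fiberDev {μ ν : Measure E} [IsFiniteMeasure μ]
    [IsFiniteMeasure ν] {π : Measure (E × E)} {μ' ν' : Measure E}
    (h : IsPartialCoupling μ ν π μ' ν') {g : E → ι} (hg : Measurable g)
    (h0 : ∀ k, μ' (g ⁻¹' {k}) = 0 ∨ ν' (g ⁻¹' {k}) = 0) (hπ : ∀ᵐ z ∂π, g z.1 = g z.2) :
    μ' Set.univ ≤ fiberDev μ ν g ∧ ν' Set.univ ≤ fiberDev μ ν g := by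
  have hk := fun k => h.left_le_abs (hg (measurableSet_singleton k))
    (hπ.mono fun z hz => by simp [hz]) (h0 k)
  rw [← tsum_measure_fiber μ' hg, ← tsum_measure_fiber ν' hg]
  exact ⟨ENNReal.tsum_le_tsum fun k => (hk k).1, ENNReal.tsum_le_tsum fun k => (hk k).2⟩

/-- Transport along a refining sequence of partitions, from the finest to the coarsest. -/
theorem exists_partialCoupling_tree (μ ν : Measure E) [IsFiniteMeasure μ] [IsFiniteMeasure ν]
    (cost : E × E → ℝ≥0∞) (m : ℕ) (g : ℕ → E → ι) (hg : ∀ j, Measurable (g j))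
    (href : ∀ j x y, g (j + 1) x = g (j + 1) y → g j x = g j y) (D : ℕ → ℝ≥0∞)
    (hD : ∀ j x y, g j x = g j y → cost (x, y) ≤ D j) :
    ∃ (π : Measure (E × E)) (μ' ν' : Measure E), IsPartialCoupling μ ν π μ' ν' ∧
      (∀ k, μ' (g 0 ⁻¹' {k}) = 0 ∨ ν' (g 0 ⁻¹' {k}) = 0) ∧ (∀ᵐ z ∂π, g 0 z.1 = g 0 z.2) ∧
      ∫⁻ z, cost z ∂π ≤
        ∑ j ∈ Finset.range m, D j * fiberDev μ ν (g (j + 1)) + D m * ν Set.univ := by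
  induction m generalizing g D with
  | zero =>
    obtain ⟨π, μ', ν', h, h0, hπ⟩ := exists_partialCoupling_fiber μ ν (hg 0)
    refine ⟨π, μ', ν', h, h0, hπ, ?_⟩
    simp only [Finset.range_zero, Finset.sum_empty, zero_add]
    calc ∫⁻ z, cost z ∂π ≤ ∫⁻ _, D 0 ∂π :=
          lintegral_mono_ae (hπ.mono fun z hz => hD 0 z.1 z.2 hz)
      _ = D 0 * π Set.univ := lintegral_const _
      _ ≤ _ := mul_le_mul_right h.univ_le_right _
  | succ m ih =>
    -- The induction hypothesis, for the shifted partitions, performs all the finer moves. The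
    -- coarsest one, within the fibers of `g 0`, comes last.
    obtain ⟨π, μ', ν', h, h0, hπ, hc⟩ := ih (fun j => g (j + 1)) (fun j => hg _)
      (fun j => href _) (fun j => D (j + 1)) (fun j => hD _)
    have : IsFiniteMeasure μ' := isFiniteMeasure_of_le μ h.left_le
    have : IsFiniteMeasure ν' := isFiniteMeasure_of_le ν h.right_le
    obtain ⟨π₂, μ'', ν'', h₂, h0₂, hπ₂⟩ := exists_partialCoupling_fiber μ' ν' (hg 0)
    refine ⟨_, _, _, h.trans h₂, h0₂, ?_, ?_⟩
    · rw [ae_add_measure_iff]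
      exact ⟨hπ.mono fun z hz => href 0 _ _ hz, hπ₂⟩
    -- Only the leftover of the previous scale is still to be moved, and its mass is at most the
    -- deviation over the fibers of `g 1`.
    · have h3 : ∫⁻ z, cost z ∂π₂ ≤ D 0 * fiberDev μ ν (g 1) :=
        calc ∫⁻ z, cost z ∂π₂ ≤ ∫⁻ _, D 0 ∂π₂ :=
              lintegral_mono_ae (hπ₂.mono fun z hz => hD 0 z.1 z.2 hz)
          _ = D 0 * π₂ Set.univ := lintegral_const _
          _ ≤ D 0 * fiberDev μ ν (g 1) := mul_le_mul_right
              (h₂.univ_le_left.trans (h.univ_le_fiberDev (hg 1) h0 hπ).1) _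
      rw [lintegral_add_measure, Finset.sum_range_succ']
      calc _ ≤ _ := add_le_add hc h3
        _ = _ := by ac_rfl

end Coupling

/-- A coupling assembled from partial couplings of the pieces of a partition. -/
theorem quadCost_le_of_pieces {d : ℕ} (μ ν : Measure (Space d)) [IsProbabilityMeasure μ]
    [IsProbabilityMeasure ν] {ι : Type*} [Countable ι] [MeasurableSpace ι]
    [MeasurableSingletonClass ι] {g : Space d → ι} (hg : Measurable g)
    {π : ι → Measure (Space d × Space d)} {μ' ν' : ι → Measure (Space d)}
    (h : ∀ k, IsPartialCoupling (μ.restrict (g ⁻¹' {k})) (ν.restrict (g ⁻¹' {k}))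
      (π k) (μ' k) (ν' k)) :
    quadCost μ ν ≤ ∑' k, (∫⁻ z, ENNReal.ofReal (‖z.1 - z.2‖ ^ 2) ∂π k +
      (2 * ∫⁻ x, ENNReal.ofReal (‖x‖ ^ 2) ∂μ' k + 2 * ∫⁻ x, ENNReal.ofReal (‖x‖ ^ 2) ∂ν' k)) := by
  have hsum := IsPartialCoupling.sum h
  rw [sum_restrict_fiber μ hg, sum_restrict_fiber ν hg] at hsum
  have : IsFiniteMeasure (Measure.sum μ') := isFiniteMeasure_of_le μ hsum.left_le
  have : IsFiniteMeasure (Measure.sum ν') := isFiniteMeasure_of_le ν hsum.right_le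
  -- The leftovers of all pieces are matched by one product coupling. As `μ` and `ν` have equal
  -- mass, nothing is left after that.
  obtain ⟨a, μ'', ν'', h₂, h0, hav, hau⟩ :=
    exists_partialCoupling_prod (Measure.sum μ') (Measure.sum ν')
  have hfull := hsum.trans h₂
  have hb := hfull.balance .univ (by simp)
  simp only [measure_univ] at hb
  have hb' : μ'' Set.univ = ν'' Set.univ := (ENNReal.add_left_inj ENNReal.one_ne_top).1 hb
  have hz : μ'' = 0 ∧ ν'' = 0 := by
    rw [← Measure.measure_univ_eq_zero, ← Measure.measure_univ_eq_zero]
    rcases h0 with h0 | h0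
    · exact ⟨h0, hb' ▸ h0⟩
    · exact ⟨hb' ▸ h0, h0⟩
  have hcoup : Measure.sum π + a • (Measure.sum μ').prod (Measure.sum ν') ∈ couplings μ ν := by
    have h1 := hfull.fst
    have h2 := hfull.snd
    rw [hz.1, add_zero] at h1
    rw [hz.2, add_zero] at h2
    exact ⟨h1, h2⟩
  refine (iInf₂_le _ hcoup).trans ?_
  have hm : Measurable fun x : Space d => ENNReal.ofReal (‖x‖ ^ 2) := by fun_prop
  have hprod : ∫⁻ z, ENNReal.ofReal (‖z.1 - z.2‖ ^ 2)
        ∂(a • (Measure.sum μ').prod (Measure.sum ν')) ≤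
      2 * ∫⁻ x, ENNReal.ofReal (‖x‖ ^ 2) ∂Measure.sum μ' +
        2 * ∫⁻ x, ENNReal.ofReal (‖x‖ ^ 2) ∂Measure.sum ν' := by
    have hpt : ∀ z : Space d × Space d, ENNReal.ofReal (‖z.1 - z.2‖ ^ 2) ≤
        2 * ENNReal.ofReal (‖z.1‖ ^ 2) + 2 * ENNReal.ofReal (‖z.2‖ ^ 2) := by
      intro z
      have e : ∀ t : ℝ, 2 * ENNReal.ofReal t = ENNReal.ofReal (2 * t) := fun t => by
        rw [ENNReal.ofReal_mul zero_le_two, ENNReal.ofReal_ofNat]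
      rw [e, e, ← ENNReal.ofReal_add (by positivity) (by positivity)]
      refine ENNReal.ofReal_le_ofReal ?_
      have h1 : ‖z.1 - z.2‖ ^ 2 ≤ (‖z.1‖ + ‖z.2‖) ^ 2 := by
        gcongr
        exact norm_sub_le _ _
      nlinarith [sq_nonneg (‖z.1‖ - ‖z.2‖)]
    rw [lintegral_smul_measure, smul_eq_mul]
    calc _ ≤ a * ∫⁻ z, (2 * ENNReal.ofReal (‖z.1‖ ^ 2) + 2 * ENNReal.ofReal (‖z.2‖ ^ 2))
            ∂(Measure.sum μ').prod (Measure.sum ν') := by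
          gcongr with z
          exact hpt z
      _ = a * (2 * (Measure.sum ν' Set.univ * ∫⁻ x, ENNReal.ofReal (‖x‖ ^ 2) ∂Measure.sum μ') +
            2 * (Measure.sum μ' Set.univ * ∫⁻ x, ENNReal.ofReal (‖x‖ ^ 2) ∂Measure.sum ν')) := by
          rw [lintegral_add_left (by fun_prop), lintegral_const_mul _ (by fun_prop),
            lintegral_const_mul _ (by fun_prop)]
          rw [← lintegral_map (f := fun x : Space d => ENNReal.ofReal (‖x‖ ^ 2)) hm measurable_fst,
            ← lintegral_map (f := fun x : Space d => ENNReal.ofReal (‖x‖ ^ 2)) hm measurable_snd,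
            Measure.map_fst_prod, Measure.map_snd_prod, lintegral_smul_measure,
            lintegral_smul_measure]
          rfl
      _ = 2 * ((a * Measure.sum ν' Set.univ) * ∫⁻ x, ENNReal.ofReal (‖x‖ ^ 2) ∂Measure.sum μ') +
            2 * ((a * Measure.sum μ' Set.univ) *
              ∫⁻ x, ENNReal.ofReal (‖x‖ ^ 2) ∂Measure.sum ν') := by ring
      _ ≤ 2 * (1 * _) + 2 * (1 * _) := by gcongr
      _ = _ := by rw [one_mul, one_mul]
  rw [lintegral_add_measure, ENNReal.tsum_add, ENNReal.tsum_add, ENNReal.tsum_mul_left,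
    ENNReal.tsum_mul_left, ← lintegral_sum_measure, ← lintegral_sum_measure,
    ← lintegral_sum_measure]
  gcongr

/-! ### Deviation inequalities for independent samples -/

section Empirical

variable {d n : ℕ}

theorem empiricalMeasure_apply (x : Fin n → Space d) {A : Set (Space d)} (hA : MeasurableSet A) :
    empiricalMeasure x A = (n : ℝ≥0∞)⁻¹ * ∑ i, A.indicator 1 (x i) := by
  simp [empiricalMeasure, Measure.dirac_apply' _ hA]

theorem empiricalMeasure_real (x : Fin n → Space d) {A : Set (Space d)} (hA : MeasurableSet A) :
    (empiricalMeasure x).real A = (n : ℝ)⁻¹ * ∑ i, A.indicator 1 (x i) := by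
  rw [Measure.real, empiricalMeasure_apply x hA, ENNReal.toReal_mul, ENNReal.toReal_inv,
    ENNReal.toReal_natCast, ENNReal.toReal_sum]
  · congr 1
    refine Finset.sum_congr rfl fun i _ => ?_
    by_cases h : x i ∈ A <;> simp [h]
  · intro i _
    by_cases h : x i ∈ A <;> simp [h]

theorem lintegral_empiricalMeasure (x : Fin n → Space d) {f : Space d → ℝ≥0∞}
    (hf : Measurable f) :
    ∫⁻ y, f y ∂empiricalMeasure x = (n : ℝ≥0∞)⁻¹ * ∑ i, f (x i) := by
  rw [empiricalMeasure, lintegral_smul_measure, lintegral_finsetSum_measure, smul_eq_mul]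
  simp [lintegral_dirac' _ hf]

theorem isProbabilityMeasure_empiricalMeasure (hn : 1 ≤ n) (x : Fin n → Space d) :
    IsProbabilityMeasure (empiricalMeasure x) := by
  constructor
  rw [empiricalMeasure_apply x .univ]
  simp only [Set.indicator_univ, Pi.one_apply, Finset.sum_const, Finset.card_univ,
    Fintype.card_fin, nsmul_eq_mul, mul_one]
  exact ENNReal.inv_mul_cancel (by simp; omega) (ENNReal.natCast_ne_top n)

end Empirical

/-- `ξ` is a sample of independent observations with law `μ`. -/
structure IsSample {d n : ℕ} {Ω : Type*} [MeasurableSpace Ω] (P : Measure Ω)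
    (ξ : Fin n → Ω → Space d) (μ : Measure (Space d)) : Prop where
  measurable : ∀ i, Measurable (ξ i)
  indep : iIndepFun ξ P
  law : ∀ i, P.map (ξ i) = μ

section Sample

variable {d n : ℕ} {Ω : Type*} [MeasurableSpace Ω] {P : Measure Ω}
  {ξ : Fin n → Ω → Space d} {μ : Measure (Space d)}

/-- Chernoff's inequality. -/
theorem IsSample.chernoff (h : IsSample P ξ μ) {f : Space d → ℝ} (hf : Measurable f) {a : ℝ}
    (ha : ∫⁻ y, ENNReal.ofReal (Real.exp (f y)) ∂μ ≤ ENNReal.ofReal (Real.exp a)) (b : ℝ) :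
    P.real {ω | n * b ≤ ∑ i, f (ξ i ω)} ≤ Real.exp (n * (a - b)) := by
  set F : Space d → ℝ≥0∞ := fun y => ENNReal.ofReal (Real.exp (f y)) with hF
  have hFm : Measurable F := by fun_prop
  have h1 : ∫⁻ ω, ∏ i, F (ξ i ω) ∂P ≤ ENNReal.ofReal (Real.exp (n * a)) := by
    rw [show (fun ω => ∏ i, F (ξ i ω)) = fun ω => ∏ i, (F ∘ ξ i) ω from rfl,
      lintegral_prod_eq_prod_lintegral_of_indepFun Finset.univ _
      (h.indep.comp (fun _ => F) fun _ => hFm) fun i => hFm.comp (h.measurable i)]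
    have : ∀ i, ∫⁻ ω, (F ∘ ξ i) ω ∂P = ∫⁻ y, F y ∂μ := fun i => by
      rw [← h.law i, lintegral_map hFm (h.measurable i)]
      rfl
    simp only [this, Finset.prod_const, Finset.card_univ, Fintype.card_fin]
    calc _ ≤ ENNReal.ofReal (Real.exp a) ^ n := pow_le_pow_left' ha n
      _ = _ := by rw [← ENNReal.ofReal_pow (Real.exp_pos _).le, ← Real.exp_nat_mul]
  have h2 : P {ω | n * b ≤ ∑ i, f (ξ i ω)} ≤
      ENNReal.ofReal (Real.exp (n * a)) / ENNReal.ofReal (Real.exp (n * b)) := by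
    refine le_trans (measure_mono ?_) ((meas_ge_le_lintegral_div (f := fun ω => ∏ i, F (ξ i ω))
      (Finset.measurable_prod _ fun i _ => hFm.comp (h.measurable i)).aemeasurable
      (ε := ENNReal.ofReal (Real.exp (n * b))) (by simpa using Real.exp_pos _)
      ENNReal.ofReal_ne_top).trans (ENNReal.div_le_div_right h1 _))
    intro ω hω
    simp only [Set.mem_ofPred_eq, hF] at hω ⊢
    rw [← ENNReal.ofReal_prod_of_nonneg fun _ _ => (Real.exp_pos _).le, ← Real.exp_sum]
    exact ENNReal.ofReal_le_ofReal (Real.exp_le_exp.2 hω)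
  rw [← ENNReal.ofReal_div_of_pos (Real.exp_pos _), ← Real.exp_sub, ← mul_sub] at h2
  exact ENNReal.toReal_le_of_le_ofReal (Real.exp_pos _).le h2

/-- The union bound for the largest observation. -/
theorem IsSample.real_exists_mem_le (h : IsSample P ξ μ) {A : Set (Space d)}
    (hA : MeasurableSet A) : P.real {ω | ∃ i, ξ i ω ∈ A} ≤ n * μ.real A := by
  have h1 : {ω | ∃ i, ξ i ω ∈ A} = ⋃ i, ξ i ⁻¹' A := by ext; simp
  rw [h1]
  refine (measureReal_iUnion_fintype_le _).trans ?_
  have : ∀ i, P.real (ξ i ⁻¹' A) = μ.real A := fun i => by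
    rw [Measure.real, Measure.real, ← h.law i, Measure.map_apply (h.measurable i) hA]
  simp [this]

theorem exp_le_one_add_add_sq {z : ℝ} (hz : |z| ≤ 1) : Real.exp z ≤ 1 + z + z ^ 2 := by
  have := Real.abs_exp_sub_one_sub_id_le hz
  linarith [le_abs_self (Real.exp z - 1 - z)]

/-- A Bernstein-type inequality. -/
theorem IsSample.bernstein [IsProbabilityMeasure P] [IsProbabilityMeasure μ] (h : IsSample P ξ μ) {f : Space d → ℝ}
    (hf : Measurable f) {B : Set (Space d)} (hB : MeasurableSet B)
    (hfB : ∀ y, |f y| ≤ B.indicator 1 y)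
    {p : ℝ} (hp : μ.real B ≤ p) {l : ℝ} (hl0 : 0 ≤ l) (hl1 : l ≤ 1) (t : ℝ) :
    P.real {ω | n * (∫ y, f y ∂μ + t) ≤ ∑ i, f (ξ i ω)} ≤
      Real.exp (n * (l ^ 2 * p - l * t)) := by
  have hind : ∀ y, B.indicator (1 : Space d → ℝ) y ≤ 1 := fun y =>
    Set.indicator_le' (fun _ _ => le_rfl) (fun _ _ => zero_le_one) y
  have hind0 : ∀ y, 0 ≤ B.indicator (1 : Space d → ℝ) y := fun y =>
    Set.indicator_nonneg (fun _ _ => zero_le_one) y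
  have hint : Integrable f μ := by
    refine Integrable.of_bound hf.aestronglyMeasurable 1 (Filter.Eventually.of_forall fun y => ?_)
    exact (hfB y).trans (hind y)
  have hintB : Integrable (B.indicator (1 : Space d → ℝ)) μ :=
    (integrable_const (1 : ℝ)).indicator hB
  -- Since `f² ≤ 1_B`, the variance term is controlled by the mass of `B`. This keeps the estimate
  -- useful for shells of small mass.
  have hpt : ∀ y, Real.exp (l * f y) ≤ 1 + l * f y + l ^ 2 * B.indicator 1 y := by
    intro y
    have h1 : |l * f y| ≤ 1 := by
      rw [abs_mul, abs_of_nonneg hl0]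
      exact mul_le_one₀ hl1 (abs_nonneg _) ((hfB y).trans (hind y))
    refine (exp_le_one_add_add_sq h1).trans ?_
    have h2 : (f y) ^ 2 ≤ B.indicator 1 y := by
      rw [← sq_abs]
      nlinarith [hfB y, hind y, hind0 y, abs_nonneg (f y)]
    rw [mul_pow]
    gcongr
  have hmgf : ∫⁻ y, ENNReal.ofReal (Real.exp (l * f y)) ∂μ ≤
      ENNReal.ofReal (Real.exp (l * ∫ y, f y ∂μ + l ^ 2 * p)) := by
    have hi : Integrable (fun y => 1 + l * f y + l ^ 2 * B.indicator (1 : Space d → ℝ) y) μ :=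
      ((integrable_const _).add (hint.const_mul l)).add (hintB.const_mul _)
    calc _ ≤ ∫⁻ y, ENNReal.ofReal (1 + l * f y + l ^ 2 * B.indicator (1 : Space d → ℝ) y) ∂μ :=
          lintegral_mono fun y => ENNReal.ofReal_le_ofReal (hpt y)
      _ = ENNReal.ofReal (∫ y, (1 + l * f y + l ^ 2 * B.indicator (1 : Space d → ℝ) y) ∂μ) :=
          (ofReal_integral_eq_lintegral_ofReal hi (Filter.Eventually.of_forall fun y =>
            (Real.exp_pos _).le.trans (hpt y))).symm
      _ ≤ _ := by
          refine ENNReal.ofReal_le_ofReal ?_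
          have e1 : ∫ y, (1 + l * f y + l ^ 2 * B.indicator (1 : Space d → ℝ) y) ∂μ =
              ∫ y, (1 + l * f y) ∂μ + ∫ y, l ^ 2 * B.indicator (1 : Space d → ℝ) y ∂μ :=
            integral_add ((integrable_const _).add (hint.const_mul l)) (hintB.const_mul _)
          have e2 : ∫ y, (1 + l * f y) ∂μ = ∫ _, (1 : ℝ) ∂μ + ∫ y, l * f y ∂μ :=
            integral_add (integrable_const _) (hint.const_mul l)
          rw [e1, e2, integral_const_mul, integral_const_mul, integral_indicator_one hB,
            integral_const, probReal_univ, one_smul]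
          have h3 : l ^ 2 * μ.real B ≤ l ^ 2 * p := by gcongr
          linarith [Real.add_one_le_exp (l * ∫ y, f y ∂μ + l ^ 2 * p)]
  have h4 := h.chernoff (f := fun y => l * f y) (hf.const_mul l) hmgf (l * (∫ y, f y ∂μ + t))
  refine (measureReal_mono ?_).trans (h4.trans_eq (congrArg _ (by ring)))
  intro ω hω
  simp only [Set.mem_ofPred_eq] at hω ⊢
  rw [← Finset.mul_sum]
  nlinarith [mul_le_mul_of_nonneg_left hω hl0]

variable {ι : Type*} [MeasurableSpace ι] [MeasurableSingletonClass ι]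

/-- The total deviation of `ν` from `μ` over the fibers of `g` in `B` with index in `F`. -/
noncomputable def cellDev (ν μ : Measure (Space d)) (B : Set (Space d)) (g : Space d → ι)
    (F : Finset ι) : ℝ :=
  ∑ k ∈ F, |ν.real (B ∩ g ⁻¹' {k}) - μ.real (B ∩ g ⁻¹' {k})|

/-- Deviation of the empirical measure over a finite partition. -/
theorem IsSample.cellDev_le [IsProbabilityMeasure P] [IsProbabilityMeasure μ] (h : IsSample P ξ μ) (hn : 1 ≤ n)
    {B : Set (Space d)} (hB : MeasurableSet B) {g : Space d → ι} (hg : Measurable g)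
    {F : Finset ι} (hF : ∀ y ∈ B, g y ∈ F)
    {p : ℝ} (hp : μ.real B ≤ p) {l : ℝ} (hl0 : 0 ≤ l) (hl1 : l ≤ 1) (t : ℝ) :
    P.real {ω | t ≤ cellDev (empiricalMeasure fun i => ξ i ω) μ B g F} ≤
      2 ^ F.card * Real.exp (n * (l ^ 2 * p - l * t)) := by
  classical
  have hn0 : (n : ℝ) ≠ 0 := by positivity
  set A : ι → Set (Space d) := fun k => B ∩ g ⁻¹' {k} with hAdef
  have hA : ∀ k, MeasurableSet (A k) := fun k => hB.inter (hg (measurableSet_singleton k))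
  set e : Finset ι → ι → ℝ := fun s k => if k ∈ s then 1 else -1 with he
  -- The sum of absolute deviations is attained by a suitable choice of signs. Each sign pattern `s`
  -- gives a function bounded by `1_B`, and there are `2 ^ F.card` of them.
  set f : Finset ι → Space d → ℝ := fun s y => ∑ k ∈ F, e s k * (A k).indicator 1 y with hf
  have hfm : ∀ s, Measurable (f s) := fun s =>
    Finset.measurable_sum _ fun k _ => ((measurable_const.indicator (hA k)).const_mul _)
  have hfB : ∀ s y, |f s y| ≤ B.indicator 1 y := by
    intro s y
    by_cases hy : y ∈ B
    · have : f s y = e s (g y) := by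
        rw [hf]
        simp only
        rw [Finset.sum_eq_single (g y)]
        · simp [hAdef, hy]
        · intro k _ hk
          simp [hAdef, Ne.symm hk]
        · intro hk
          exact absurd (hF y hy) hk
      rw [this, Set.indicator_of_mem hy, Pi.one_apply, he]
      simp only
      split_ifs <;> simp
    · have : f s y = 0 := Finset.sum_eq_zero fun k _ => by simp [hAdef, hy]
      simp [this, hy]
  have hfint : ∀ s, ∫ y, f s y ∂μ = ∑ k ∈ F, e s k * μ.real (A k) := by
    intro s
    have e1 : ∫ y, f s y ∂μ = ∑ k ∈ F, ∫ y, e s k * (A k).indicator 1 y ∂μ :=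
      integral_finsetSum _ fun k _ =>
        ((integrable_const (1 : ℝ)).indicator (hA k)).const_mul (e s k)
    rw [e1]
    refine Finset.sum_congr rfl fun k _ => ?_
    rw [integral_const_mul]
    congr 1
    exact integral_indicator_one (hA k)
  have hsub : {ω | t ≤ cellDev (empiricalMeasure fun i => ξ i ω) μ B g F} ⊆
      ⋃ s ∈ F.powerset, {ω | n * (∫ y, f s y ∂μ + t) ≤ ∑ i, f s (ξ i ω)} := by
    intro ω hω
    set ν := empiricalMeasure fun i => ξ i ω with hν
    set s := F.filter fun k => 0 ≤ ν.real (A k) - μ.real (A k) with hs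
    simp only [Set.mem_iUnion, Finset.mem_powerset, Set.mem_ofPred_eq, exists_prop]
    refine ⟨s, Finset.filter_subset _ _, ?_⟩
    have h1 : cellDev ν μ B g F = ∑ k ∈ F, e s k * (ν.real (A k) - μ.real (A k)) := by
      refine Finset.sum_congr rfl fun k hk => ?_
      by_cases h0 : 0 ≤ ν.real (A k) - μ.real (A k)
      · have : k ∈ s := Finset.mem_filter.2 ⟨hk, h0⟩
        simp only [he, this, if_true, one_mul]
        exact abs_of_nonneg h0
      · have : k ∉ s := fun h => h0 (Finset.mem_filter.1 h).2
        simp only [he, this, if_false]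
        rw [neg_one_mul]
        exact abs_of_neg (not_le.1 h0)
    have h2 : ∑ i, f s (ξ i ω) = n * ∑ k ∈ F, e s k * ν.real (A k) := by
      rw [hf]
      simp only
      rw [Finset.sum_comm, Finset.mul_sum]
      refine Finset.sum_congr rfl fun k _ => ?_
      rw [hν, empiricalMeasure_real _ (hA k), ← Finset.mul_sum]
      field_simp
    have h3 : t ≤ cellDev ν μ B g F := hω
    rw [h1] at h3
    simp only [mul_sub, Finset.sum_sub_distrib] at h3
    rw [h2, hfint]
    have : (0 : ℝ) ≤ n := by positivity
    nlinarith [mul_le_mul_of_nonneg_left h3 this]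
  calc _ ≤ P.real (⋃ s ∈ F.powerset, {ω | n * (∫ y, f s y ∂μ + t) ≤ ∑ i, f s (ξ i ω)}) :=
        measureReal_mono hsub (measure_ne_top _ _)
    _ ≤ ∑ s ∈ F.powerset, P.real {ω | n * (∫ y, f s y ∂μ + t) ≤ ∑ i, f s (ξ i ω)} :=
        measureReal_biUnion_finset_le _ _
    _ ≤ ∑ s ∈ F.powerset, Real.exp (n * (l ^ 2 * p - l * t)) :=
        Finset.sum_le_sum fun s _ => h.bernstein (hfm s) hB (hfB s) hp hl0 hl1 t
    _ = _ := by rw [Finset.sum_const, Finset.card_powerset, nsmul_eq_mul]; push_cast; rfl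

end Sample

/-! ### Dyadic shells and cells -/

section Dyadic

variable {d : ℕ}

/-- The index of the dyadic shell that contains `x`: the least `n` with `‖x‖ < 2 ^ n`. -/
noncomputable def shell (x : Space d) : ℕ := Nat.size ⌊‖x‖⌋₊

theorem shell_le_iff {x : Space d} {n : ℕ} : shell x ≤ n ↔ ‖x‖ < 2 ^ n := by
  rw [shell, Nat.size_le, Nat.floor_lt (norm_nonneg x)]
  simp

theorem measurable_shell : Measurable (shell : Space d → ℕ) :=
  (Measurable.of_discrete (f := Nat.size)).comp (Nat.measurable_floor.comp measurable_norm)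

/-- The dyadic cell of side `2 ^ n / 2 ^ j` that contains `x`. -/
noncomputable def cell (n j : ℕ) (x : Space d) : Fin d → ℤ :=
  fun i => ⌊(2 : ℝ) ^ j * x i / 2 ^ n⌋

/-- The indices of the cells that meet the ball of radius `2 ^ n`. -/
noncomputable def cellBox (d j : ℕ) : Finset (Fin d → ℤ) :=
  Fintype.piFinset fun _ => Finset.Ico (-2 ^ j) (2 ^ j)

theorem card_cellBox (d j : ℕ) : (cellBox d j).card = 2 ^ d * (2 ^ d) ^ j := by
  rw [cellBox, Fintype.card_piFinset_const, Int.card_Ico]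
  have : ((2 : ℤ) ^ j - -2 ^ j).toNat = 2 * 2 ^ j := by
    have h : ((2 : ℤ) ^ j - -2 ^ j) = ((2 * 2 ^ j : ℕ) : ℤ) := by push_cast; ring
    rw [h, Int.toNat_natCast]
  rw [this, mul_pow, ← pow_mul, ← pow_mul, mul_comm j d]

theorem measurable_cell (n j : ℕ) : Measurable (cell (d := d) n j) := by
  refine measurable_pi_lambda _ fun i => Int.measurable_floor.comp ?_
  fun_prop

/-- This makes the dyadic partitions nested, as the transport along a refining sequence requires. -/
theorem floor_eq_of_floor_two_mul_eq {u v : ℝ} (h : ⌊2 * u⌋ = ⌊2 * v⌋) : ⌊u⌋ = ⌊v⌋ := by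
  have key : ∀ {u v : ℝ}, ⌊2 * u⌋ = ⌊2 * v⌋ → ⌊u⌋ ≤ ⌊v⌋ := by
    intro u v h
    have h1 : 2 * ⌊u⌋ ≤ ⌊2 * u⌋ := Int.le_floor.2 (by
      push_cast
      linarith [Int.floor_le u])
    rw [h, Int.le_floor] at h1
    push_cast at h1
    exact Int.le_floor.2 (by linarith)
  exact le_antisymm (key h) (key h.symm)

theorem cell_eq_of_cell_succ_eq {n j : ℕ} {x y : Space d} (h : cell n (j + 1) x = cell n (j + 1) y) :
    cell n j x = cell n j y := by
  funext i
  refine floor_eq_of_floor_two_mul_eq ?_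
  have h1 := congrFun h i
  simp only [cell, pow_succ'] at h1
  convert h1 using 2 <;> ring

theorem sq_norm_sub_le_of_cell_eq {n j : ℕ} {x y : Space d} (h : cell n j x = cell n j y) :
    ‖x - y‖ ^ 2 ≤ d * (4 ^ n / 4 ^ j) := by
  have h1 : ∀ i, ‖(x - y) i‖ ^ 2 ≤ (4 : ℝ) ^ n / 4 ^ j := by
    intro i
    have h2 := Int.abs_sub_lt_one_of_floor_eq_floor (congrFun h i)
    have h3 : (2 : ℝ) ^ j * x i / 2 ^ n - 2 ^ j * y i / 2 ^ n = (2 ^ j / 2 ^ n) * (x i - y i) := by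
      ring
    rw [h3, abs_mul, abs_of_pos (by positivity), div_mul_eq_mul_div, div_lt_one (by positivity),
      mul_comm, ← lt_div_iff₀ (by positivity)] at h2
    have h4 : ((4 : ℝ) ^ n / 4 ^ j) = (2 ^ n / 2 ^ j) ^ 2 := by
      rw [div_pow, ← pow_mul, ← pow_mul, mul_comm n, mul_comm j, pow_mul, pow_mul]
      norm_num
    rw [h4, PiLp.sub_apply, Real.norm_eq_abs]
    exact pow_le_pow_left₀ (abs_nonneg _) h2.le 2
  rw [EuclideanSpace.norm_sq_eq]
  calc _ ≤ ∑ _i : Fin d, (4 : ℝ) ^ n / 4 ^ j := Finset.sum_le_sum fun i _ => h1 i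
    _ = _ := by simp

theorem cell_mem_cellBox {n j : ℕ} {x : Space d} (h : ‖x‖ < 2 ^ n) : cell n j x ∈ cellBox d j := by
  rw [cellBox, Fintype.mem_piFinset]
  intro i
  have h1 : |x i| < 2 ^ n := (PiLp.norm_apply_le x i).trans_lt h
  rw [abs_lt] at h1
  rw [Finset.mem_Ico]
  constructor
  · rw [cell, Int.le_floor, le_div_iff₀ (by positivity)]
    push_cast
    rw [neg_mul, ← mul_neg]
    gcongr
    exact h1.1.le
  · rw [cell, Int.floor_lt, div_lt_iff₀ (by positivity)]
    push_cast
    gcongr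
    exact h1.2

theorem fiberDev_restrict {E ι : Type*} [MeasurableSpace E] [MeasurableSpace ι]
    [MeasurableSingletonClass ι] (ν μ : Measure E) (B : Set E) {g : E → ι} (hg : Measurable g)
    {F : Finset ι} (hF : ∀ y ∈ B, g y ∈ F) :
    fiberDev (ν.restrict B) (μ.restrict B) g =
      ENNReal.ofReal (∑ k ∈ F, |ν.real (B ∩ g ⁻¹' {k}) - μ.real (B ∩ g ⁻¹' {k})|) := by
  have h1 : ∀ (m : Measure E) k, (m.restrict B).real (g ⁻¹' {k}) = m.real (B ∩ g ⁻¹' {k}) := by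
    intro m k
    rw [measureReal_restrict_apply (hg (measurableSet_singleton k)), Set.inter_comm]
  rw [fiberDev, tsum_eq_sum (s := F), ENNReal.ofReal_sum_of_nonneg fun _ _ => abs_nonneg _]
  · simp only [h1]
  · intro k hk
    have : B ∩ g ⁻¹' {k} = ∅ := by
      ext y
      simp only [Set.mem_inter_iff, Set.mem_preimage, Set.mem_singleton_iff,
        Set.mem_empty_iff_false, iff_false, not_and]
      rintro hy rfl
      exact hk (hF y hy)
    simp [h1, this]

theorem cellDev_nonneg {ι : Type*} [MeasurableSpace ι] (ν μ : Measure (Space d))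
    (B : Set (Space d)) (g : Space d → ι) (F : Finset ι) : 0 ≤ cellDev ν μ B g F :=
  Finset.sum_nonneg fun _ _ => abs_nonneg _

/-- The deviation of `ν` from `μ` over the cells of the `n`-th shell, with cells of side
`2 ^ n / 2 ^ j`. -/
noncomputable def shellDev (ν μ : Measure (Space d)) (n j : ℕ) : ℝ :=
  cellDev ν μ (shell ⁻¹' {n}) (cell n j) (cellBox d j)

/-- The transport bound for the `n`-th shell, with `m + 1` scales. -/
noncomputable def shellBound (ν μ : Measure (Space d)) (n m : ℕ) : ℝ :=
  ∑ j ∈ Finset.range (m + 1), shellDev ν μ n j / 4 ^ j + μ.real (shell ⁻¹' {n}) / 4 ^ m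

theorem norm_lt_of_mem_shell {n : ℕ} {x : Space d} (h : x ∈ shell ⁻¹' {n}) : ‖x‖ < 2 ^ n :=
  shell_le_iff.1 (le_of_eq h)

/-- Transport within a shell. -/
theorem exists_partialCoupling_shell (ν μ : Measure (Space d)) [IsFiniteMeasure ν]
    [IsFiniteMeasure μ] (n m : ℕ) :
    ∃ (π : Measure (Space d × Space d)) (ν' μ' : Measure (Space d)),
      IsPartialCoupling (ν.restrict (shell ⁻¹' {n})) (μ.restrict (shell ⁻¹' {n})) π ν' μ' ∧
      ∫⁻ z, ENNReal.ofReal (‖z.1 - z.2‖ ^ 2) ∂π +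
        (2 * ∫⁻ x, ENNReal.ofReal (‖x‖ ^ 2) ∂ν' + 2 * ∫⁻ x, ENNReal.ofReal (‖x‖ ^ 2) ∂μ') ≤
      ENNReal.ofReal ((4 * d + 4) * 4 ^ n * shellBound ν μ n m) := by
  set A : Set (Space d) := shell ⁻¹' {n} with hA
  have hAm : MeasurableSet A := measurable_shell (measurableSet_singleton n)
  obtain ⟨π, ν', μ', h, h0, hπ, hc⟩ := exists_partialCoupling_tree (ν.restrict A) (μ.restrict A)
    (fun z => ENNReal.ofReal (‖z.1 - z.2‖ ^ 2)) m (cell n) (measurable_cell n)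
    (fun j x y => cell_eq_of_cell_succ_eq) (fun j => ENNReal.ofReal (d * (4 ^ n / 4 ^ j)))
    (fun j x y hxy => ENNReal.ofReal_le_ofReal (sq_norm_sub_le_of_cell_eq hxy))
  refine ⟨π, ν', μ', h, ?_⟩
  have hdev : ∀ j, fiberDev (ν.restrict A) (μ.restrict A) (cell n j) =
      ENNReal.ofReal (shellDev ν μ n j) := fun j =>
    fiberDev_restrict ν μ A (measurable_cell n j)
      fun y hy => cell_mem_cellBox (norm_lt_of_mem_shell hy)
  have hdev0 : ∀ j, 0 ≤ shellDev ν μ n j := fun j => cellDev_nonneg _ _ _ _ _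
  have hleft := h.univ_le_fiberDev (measurable_cell n 0) h0 hπ
  rw [hdev] at hleft
  -- What even the coarsest cells could not match has mass at most `shellDev` at scale `0` and lies
  -- in the ball of radius `2 ^ n`. The two leftovers give the summand `4` of `4 * d + 4`. The
  -- factor `4 * d` comes from moving at scale `j` a mass estimated at scale `j + 1`.
  have hbd : ∀ {ρ ρ' : Measure (Space d)}, ρ' ≤ ρ.restrict A →
      ρ' Set.univ ≤ ENNReal.ofReal (shellDev ν μ n 0) →
      2 * ∫⁻ x, ENNReal.ofReal (‖x‖ ^ 2) ∂ρ' ≤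
        ENNReal.ofReal (2 * 4 ^ n * shellDev ν μ n 0) := by
    intro ρ ρ' hle hun
    have hae : ∀ᵐ x ∂ρ', x ∈ A := (Measure.absolutelyContinuous_of_le hle).ae_le (ae_restrict_mem hAm)
    have h1 : ∫⁻ x, ENNReal.ofReal (‖x‖ ^ 2) ∂ρ' ≤ ∫⁻ _, ENNReal.ofReal (4 ^ n) ∂ρ' := by
      refine lintegral_mono_ae (hae.mono fun x hx => ENNReal.ofReal_le_ofReal ?_)
      calc ‖x‖ ^ 2 ≤ (2 ^ n) ^ 2 :=
            pow_le_pow_left₀ (norm_nonneg _) (norm_lt_of_mem_shell hx).le 2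
        _ = 4 ^ n := by rw [← pow_mul, mul_comm, pow_mul]; norm_num
    rw [lintegral_const] at h1
    rw [mul_assoc, ENNReal.ofReal_mul zero_le_two, ENNReal.ofReal_mul (by positivity),
      ENNReal.ofReal_ofNat]
    gcongr
    exact h1.trans (mul_le_mul_right hun _)
  have hb1 := hbd h.left_le hleft.1
  have hb2 := hbd h.right_le hleft.2
  have hc' : ∫⁻ z, ENNReal.ofReal (‖z.1 - z.2‖ ^ 2) ∂π ≤ ENNReal.ofReal
      (∑ j ∈ Finset.range m, d * (4 ^ n / 4 ^ j) * shellDev ν μ n (j + 1) +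
        d * (4 ^ n / 4 ^ m) * μ.real A) := by
    refine hc.trans_eq ?_
    rw [ENNReal.ofReal_add (Finset.sum_nonneg fun j _ => mul_nonneg (by positivity) (hdev0 _))
      (by positivity), ENNReal.ofReal_sum_of_nonneg fun j _ => mul_nonneg (by positivity) (hdev0 _)]
    congr 1
    · refine Finset.sum_congr rfl fun j _ => ?_
      rw [hdev, ← ENNReal.ofReal_mul (by positivity)]
    · rw [ENNReal.ofReal_mul (p := d * (4 ^ n / 4 ^ m)) (by positivity),
        Measure.restrict_apply_univ, ofReal_measureReal]
  refine (add_le_add hc' (add_le_add hb1 hb2)).trans ?_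
  have hnn : ∀ c : ℝ, 0 ≤ c → 0 ≤ c * 4 ^ n * shellDev ν μ n 0 := fun c hc =>
    mul_nonneg (by positivity) (hdev0 0)
  rw [← ENNReal.ofReal_add (hnn 2 zero_le_two) (hnn 2 zero_le_two), ← ENNReal.ofReal_add
    (add_nonneg (Finset.sum_nonneg fun j _ => mul_nonneg (by positivity) (hdev0 _))
      (by positivity)) (add_nonneg (hnn 2 zero_le_two) (hnn 2 zero_le_two))]
  refine ENNReal.ofReal_le_ofReal ?_
  have e1 : ∑ j ∈ Finset.range m, d * (4 ^ n / 4 ^ j) * shellDev ν μ n (j + 1) =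
      4 * d * 4 ^ n * ∑ j ∈ Finset.range m, shellDev ν μ n (j + 1) / 4 ^ (j + 1) := by
    rw [Finset.mul_sum]
    refine Finset.sum_congr rfl fun j _ => ?_
    rw [pow_succ]
    field_simp
  have e2 : 0 ≤ ∑ j ∈ Finset.range m, shellDev ν μ n (j + 1) / 4 ^ (j + 1) :=
    Finset.sum_nonneg fun j _ => div_nonneg (hdev0 _) (by positivity)
  have e3 : 0 ≤ μ.real A / 4 ^ m := by positivity
  rw [e1, shellBound, Finset.sum_range_succ', ← hA]
  set S := ∑ j ∈ Finset.range m, shellDev ν μ n (j + 1) / 4 ^ (j + 1)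
  set V := μ.real A / 4 ^ m with hV
  have e4 : (d : ℝ) * (4 ^ n / 4 ^ m) * μ.real A = d * 4 ^ n * V := by rw [hV]; ring
  rw [e4, pow_zero, div_one]
  have f1 : 0 ≤ (4 : ℝ) ^ n * S := by positivity
  have f2 : 0 ≤ (d : ℝ) * 4 ^ n * V := by positivity
  have f3 : 0 ≤ (4 : ℝ) ^ n * V := by positivity
  have f4 : 0 ≤ (d : ℝ) * 4 ^ n * shellDev ν μ n 0 := mul_nonneg (by positivity) (hdev0 0)
  nlinarith

/-- A multiscale bound for the quadratic transport cost. -/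
theorem quadCost_le (ν μ : Measure (Space d)) [IsProbabilityMeasure ν] [IsProbabilityMeasure μ]
    (M : ℕ) (m : ℕ → ℕ) :
    quadCost ν μ ≤ ENNReal.ofReal
        (∑ n ∈ Finset.range M, (4 * d + 4) * 4 ^ n * shellBound ν μ n (m n)) +
      (2 * ∫⁻ x in {x | M ≤ shell x}, ENNReal.ofReal (‖x‖ ^ 2) ∂ν +
        2 * ∫⁻ x in {x | M ≤ shell x}, ENNReal.ofReal (‖x‖ ^ 2) ∂μ) := by
  have hM : MeasurableSet {x : Space d | M ≤ shell x} := measurable_shell measurableSet_Ici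
  choose π ν' μ' h hc using fun n => exists_partialCoupling_shell ν μ n (m n)
  -- In the shells from `M` on nothing is moved at this stage. Their whole mass is leftover and pays
  -- its second moment.
  have hcoup : ∀ n, IsPartialCoupling (ν.restrict (shell ⁻¹' {n})) (μ.restrict (shell ⁻¹' {n}))
      (if n < M then π n else 0) (if n < M then ν' n else ν.restrict (shell ⁻¹' {n}))
      (if n < M then μ' n else μ.restrict (shell ⁻¹' {n})) := by
    intro n
    split_ifs
    · exact h n
    · exact .zero _ _
  refine (quadCost_le_of_pieces ν μ measurable_shell hcoup).trans ?_
  set T : Measure (Space d) → ℕ → ℝ≥0∞ := fun ρ n =>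
    ∫⁻ x, ENNReal.ofReal (‖x‖ ^ 2) ∂((ρ.restrict {x | M ≤ shell x}).restrict (shell ⁻¹' {n}))
    with hT
  have hTsum : ∀ ρ : Measure (Space d), ∑' n, T ρ n =
      ∫⁻ x in {x | M ≤ shell x}, ENNReal.ofReal (‖x‖ ^ 2) ∂ρ := by
    intro ρ
    rw [hT]
    simp only
    rw [← lintegral_sum_measure, sum_restrict_fiber _ measurable_shell]
  have hTeq : ∀ (ρ : Measure (Space d)) n, ¬ n < M →
      ∫⁻ x in shell ⁻¹' {n}, ENNReal.ofReal (‖x‖ ^ 2) ∂ρ = T ρ n := by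
    intro ρ n hn
    rw [hT]
    simp only
    rw [Measure.restrict_restrict (measurable_shell (measurableSet_singleton n))]
    congr 2
    refine (Set.inter_eq_left.2 ?_).symm
    intro x hx
    have : shell x = n := hx
    simp only [Set.mem_ofPred_eq]
    omega
  set b : ℕ → ℝ := fun n => (4 * d + 4) * 4 ^ n * shellBound ν μ n (m n) with hb
  have hb0 : ∀ n, 0 ≤ b n := fun n => mul_nonneg (by positivity) (add_nonneg
    (Finset.sum_nonneg fun j _ => div_nonneg (cellDev_nonneg _ _ _ _ _) (by positivity))
    (by positivity))
  calc _ ≤ ∑' n, ((if n < M then ENNReal.ofReal (b n) else 0) + (2 * T ν n + 2 * T μ n)) := by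
        refine ENNReal.tsum_le_tsum fun n => ?_
        split_ifs with hn
        · exact (hc n).trans le_self_add
        · rw [hTeq ν n hn, hTeq μ n hn, lintegral_zero_measure]
    _ = _ := by
        rw [ENNReal.tsum_add, ENNReal.tsum_add, ENNReal.tsum_mul_left, ENNReal.tsum_mul_left,
          hTsum, hTsum, ENNReal.ofReal_sum_of_nonneg fun n _ => hb0 n,
          tsum_eq_sum (s := Finset.range M)]
        · congr 1
          exact Finset.sum_congr rfl fun n hn => by simp [Finset.mem_range.1 hn]
        · intro n hn
          simp [Finset.mem_range.not.1 hn]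

end Dyadic

/-! ### The rate function -/

/-- The square of `rate d x` is, up to constants, the exponent in `boundA`. -/
noncomputable def rate (d : ℕ) (y : ℝ) : ℝ :=
  if d ≤ 3 then y / 4
  else if d = 4 then y / (4 * Real.log (2 + 1 / y))
  else y ^ ((d : ℝ) / 4) / √(2 ^ d)

theorem one_le_log_two_add_inv {y : ℝ} (hy : 0 < y) (hy1 : y ≤ 1) : 1 ≤ Real.log (2 + 1 / y) := by
  have h1 : 1 ≤ 1 / y := (one_le_div hy).2 hy1
  rw [Real.le_log_iff_exp_le (by positivity)]
  linarith [Real.exp_one_lt_d9]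

theorem log_two_add_inv_pos {y : ℝ} (hy : 0 < y) : 0 < Real.log (2 + 1 / y) :=
  Real.log_pos (by have : 0 < 1 / y := by positivity
                   linarith)

theorem rate_pos (d : ℕ) {y : ℝ} (hy : 0 < y) : 0 < rate d y := by
  have := log_two_add_inv_pos hy
  unfold rate
  split_ifs <;> positivity

theorem one_le_sqrt_two_pow (d : ℕ) : 1 ≤ √((2 : ℝ) ^ d) :=
  Real.one_le_sqrt.2 (one_le_pow₀ one_le_two)

theorem rate_le (d : ℕ) {y : ℝ} (hy : 0 < y) (hy1 : y ≤ 1) : rate d y ≤ y := by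
  unfold rate
  split_ifs with h3 h4
  · linarith
  · exact div_le_self hy.le (by linarith [one_le_log_two_add_inv hy hy1])
  · refine (div_le_self (by positivity) (one_le_sqrt_two_pow d)).trans ?_
    have hd : (4 : ℝ) ≤ d := by exact_mod_cast (by omega : 4 ≤ d)
    exact Real.rpow_le_self_of_le_one hy.le hy1 (by linarith)

/-- The quotient `rate d y / y` is nondecreasing in every dimension. Outer shells, where a larger
accuracy is allowed, therefore gain at least linearly. -/
theorem mul_rate_le (d : ℕ) {l y : ℝ} (hl : 1 ≤ l) (hy : 0 < y) : l * rate d y ≤ rate d (l * y) := by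
  have hl0 : 0 < l := by linarith
  unfold rate
  split_ifs with h3 h4
  · linarith
  · have h1 := log_two_add_inv_pos (mul_pos hl0 hy)
    rw [← mul_div_assoc]
    refine div_le_div_of_nonneg_left (by positivity) (by positivity) ?_
    have h2 : 1 / (l * y) ≤ 1 / y :=
      one_div_le_one_div_of_le hy (le_mul_of_one_le_left hy.le hl)
    gcongr
  · rw [← mul_div_assoc, Real.mul_rpow hl0.le hy.le]
    have hd : (4 : ℝ) ≤ d := by exact_mod_cast (by omega : 4 ≤ d)
    gcongr
    exact Real.self_le_rpow_of_one_le hl (by linarith)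

/-- Shrinking the argument by a fixed factor costs only a constant. For `d = 4` this is so because
`log (2 + 1 / y)` is bounded below by `log 2`, which absorbs the additional `log (1 / κ)`. -/
theorem exists_mul_rate_le (d : ℕ) {κ : ℝ} (hκ : 0 < κ) (hκ1 : κ ≤ 1) :
    ∃ c : ℝ, 0 < c ∧ ∀ y : ℝ, 0 < y → c * rate d y ≤ rate d (κ * y) := by
  unfold rate
  split_ifs with h3 h4
  · exact ⟨κ, hκ, fun y _ => by linarith⟩
  · have hlκ : 0 ≤ Real.log (1 / κ) := Real.log_nonneg ((one_le_div hκ).2 hκ1)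
    have hl2 : 0 < Real.log 2 := Real.log_pos one_lt_two
    set B := 1 + Real.log (1 / κ) / Real.log 2 with hB
    have hB0 : 0 < B := by positivity
    refine ⟨κ / B, by positivity, fun y hy => ?_⟩
    have hly := log_two_add_inv_pos hy
    have hlky := log_two_add_inv_pos (mul_pos hκ hy)
    have h1 : Real.log (2 + 1 / (κ * y)) ≤ B * Real.log (2 + 1 / y) := by
      have h2 : 2 + 1 / (κ * y) ≤ 1 / κ * (2 + 1 / y) := by
        have : 2 ≤ 1 / κ * 2 := le_mul_of_one_le_left zero_le_two ((one_le_div hκ).2 hκ1)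
        rw [mul_add, one_div_mul_one_div]
        linarith
      have h3 : Real.log 2 ≤ Real.log (2 + 1 / y) :=
        Real.log_le_log two_pos (by have : 0 < 1 / y := by positivity
                                    linarith)
      calc _ ≤ Real.log (1 / κ * (2 + 1 / y)) := Real.log_le_log (by positivity) h2
        _ = Real.log (1 / κ) + Real.log (2 + 1 / y) :=
          Real.log_mul (by positivity) (by positivity)
        _ = Real.log (1 / κ) / Real.log 2 * Real.log 2 + Real.log (2 + 1 / y) := by
          rw [div_mul_cancel₀ _ hl2.ne']
        _ ≤ Real.log (1 / κ) / Real.log 2 * Real.log (2 + 1 / y) + Real.log (2 + 1 / y) := by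
          gcongr
        _ = _ := by rw [hB]; ring
    rw [div_mul_div_comm]
    refine div_le_div_of_nonneg_left (by positivity) (by positivity) ?_
    linarith
  · refine ⟨κ ^ ((d : ℝ) / 4), by positivity, fun y hy => ?_⟩
    rw [Real.mul_rpow hκ.le hy.le, mul_div_assoc]

theorem sum_pow_le_of_five_le {r : ℝ} (hr : 5 ≤ 4 * r) (m : ℕ) :
    ∑ j ∈ Finset.range (m + 1), r ^ j ≤ 5 * r ^ m := by
  have hr0 : 0 ≤ r := by linarith
  induction m with
  | zero => simp
  | succ m ih =>
    rw [Finset.sum_range_succ]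
    have : 0 ≤ r ^ m := by positivity
    rw [pow_succ]
    nlinarith

theorem sum_pow_le_inv {r : ℝ} (hr0 : 0 ≤ r) (hr : r < 1) (m : ℕ) :
    ∑ j ∈ Finset.range m, r ^ j ≤ (1 - r)⁻¹ := by
  rw [← tsum_geometric_of_lt_one hr0 hr]
  exact (summable_geometric_of_lt_one hr0 hr).sum_le_tsum _ fun _ _ => by positivity

/-- The number of scales to be used at accuracy `y`. -/
theorem exists_scale (d : ℕ) {y : ℝ} (hy : 0 < y) (hy1 : y ≤ 1) :
    ∃ m : ℕ, 1 / 4 ^ m ≤ y ∧ rate d y * √(2 ^ d) ^ m ≤ 1 ∧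
      rate d y * ∑ j ∈ Finset.range (m + 1), (√(2 ^ d) / 4) ^ j ≤ 5 * y := by
  -- With `m = k + 1` the truncation error `4^(-m)` is at most `y`, while `y 4^m ≤ 4`. The first
  -- bound makes the finest scale cheap, the second limits the number of scales.
  obtain ⟨k, hk1, hk2⟩ := exists_nat_pow_near_of_lt_one hy hy1 (y := (1 / 4 : ℝ)) (by norm_num)
    (by norm_num)
  have h4 : y * 4 ^ (k + 1) ≤ 4 := by
    have : y * 4 ^ k ≤ 1 := by
      calc y * 4 ^ k ≤ (1 / 4) ^ k * 4 ^ k := by gcongr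
        _ = 1 := by rw [← mul_pow]; norm_num
    rw [pow_succ]
    linarith
  have hk3 : 1 / (4 : ℝ) ^ (k + 1) ≤ y := by
    rw [← one_div_pow]
    exact hk1.le
  generalize k + 1 = m at h4 hk3
  refine ⟨m, hk3, ?_⟩
  set b := √((2 : ℝ) ^ d) with hb
  have hb1 : 1 ≤ b := one_le_sqrt_two_pow d
  rcases Nat.lt_or_ge 4 d with hd | hd
  · have hd3 : ¬ d ≤ 3 := by omega
    have hd4 : ¬ d = 4 := by omega
    simp only [rate, hd3, hd4, if_false, ← hb]
    have hb5 : 5 ≤ b := Real.le_sqrt_of_sq_le (by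
      calc ((5 : ℝ)) ^ 2 ≤ 2 ^ 5 := by norm_num
        _ ≤ 2 ^ d := pow_le_pow_right₀ one_le_two hd)
    have hb4 : b = (4 : ℝ) ^ ((d : ℝ) / 4) := by
      rw [hb, Real.sqrt_eq_rpow, ← Real.rpow_natCast, ← Real.rpow_mul zero_le_two,
        show (4 : ℝ) = 2 ^ (2 : ℝ) by norm_num, ← Real.rpow_mul zero_le_two]
      congr 1
      ring
    -- Here `b = 4^(d/4)`, so `y^(d/4) b^m = (y 4^m)^(d/4) ≤ b`. This is the reason for the divisor
    -- `√(2 ^ d)` in `rate`. The ratio `b / 4` is at least `5 / 4`, and the last scale dominates the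
    -- sum.
    have h1 : y ^ ((d : ℝ) / 4) / b * b ^ m ≤ 1 := by
      have e1 : b ^ m = ((4 : ℝ) ^ m) ^ ((d : ℝ) / 4) := by
        rw [hb4, ← Real.rpow_natCast, ← Real.rpow_natCast, ← Real.rpow_mul (by norm_num),
          ← Real.rpow_mul (by norm_num), mul_comm]
      rw [div_mul_eq_mul_div, e1, ← Real.mul_rpow hy.le (by positivity), div_le_one (by positivity),
        hb4]
      gcongr
    refine ⟨h1, ?_⟩
    calc _ ≤ y ^ ((d : ℝ) / 4) / b * (5 * (b / 4) ^ m) := by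
          gcongr
          exact sum_pow_le_of_five_le (by linarith) m
      _ = 5 * (y ^ ((d : ℝ) / 4) / b * b ^ m * (1 / 4 ^ m)) := by rw [div_pow]; ring
      _ ≤ 5 * (1 * y) := by gcongr
      _ = _ := by ring
  · rcases hd.eq_or_lt with hd4 | hd4
    · subst hd4
      have hb4 : b = 4 := by
        rw [hb, show (2 : ℝ) ^ 4 = 4 ^ 2 by norm_num, Real.sqrt_sq (by norm_num)]
      have hlog := one_le_log_two_add_inv hy hy1
      simp only [rate, hb4]
      norm_num only
      simp only [if_true, if_false, one_pow, Finset.sum_const, Finset.card_range, nsmul_eq_mul, mul_one]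
      set ℓ := Real.log (2 + 1 / y) with hℓ
      constructor
      · rw [div_mul_eq_mul_div, div_le_one (by positivity)]
        linarith
      -- In the critical dimension all scales contribute equally, and their number is logarithmic in
      -- `1 / y`.
      · have hm : (m : ℝ) + 1 ≤ 4 * ℓ := by
          have e1 : (4 : ℝ) ^ m ≤ 4 * (2 + 1 / y) := by
            have : (4 : ℝ) ^ m ≤ 4 / y := by rw [le_div_iff₀ hy]; linarith
            rw [mul_add, mul_one_div]
            linarith
          have e2 := Real.log_le_log (by positivity) e1
          rw [Real.log_pow, Real.log_mul (by norm_num) (by positivity), ← hℓ] at e2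
          have e3 : Real.log 4 = 2 * Real.log 2 := by
            rw [show (4 : ℝ) = 2 ^ 2 by norm_num, Real.log_pow]
            norm_num
          have e4 := Real.log_two_gt_d9
          have e5 := Real.log_two_lt_d9
          have e6 : (m : ℝ) * 1 ≤ m * Real.log 4 := by gcongr; linarith
          linarith
        rw [div_mul_eq_mul_div, div_le_iff₀ (by positivity)]
        push_cast
        nlinarith [mul_le_mul_of_nonneg_left hm hy.le, mul_pos hy (by linarith : 0 < ℓ)]
    · have hd3 : d ≤ 3 := by omega
      simp only [rate, hd3, if_true]
      have hb3 : b ≤ 3 := (Real.sqrt_le_left (by norm_num)).2 (by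
        calc (2 : ℝ) ^ d ≤ 2 ^ 3 := pow_le_pow_right₀ one_le_two hd3
          _ ≤ 3 ^ 2 := by norm_num)
      constructor
      · calc y / 4 * b ^ m ≤ y / 4 * 4 ^ m := by gcongr; linarith
          _ ≤ 1 := by linarith
      · have : ∑ j ∈ Finset.range (m + 1), (b / 4) ^ j ≤ (1 - b / 4)⁻¹ :=
          sum_pow_le_inv (by positivity) (by linarith) _
        have h2 : (1 - b / 4)⁻¹ ≤ 4 := by
          rw [inv_le_comm₀ (by linarith) (by norm_num)]
          linarith
        nlinarith

/-- The factor `16 * 2 ^ d` undoes the squared normalisations `1 / 4` and `1 / √(2 ^ d)` of `rate`,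
uniformly in the three cases. -/
theorem le_boundA (d : ℕ) {c C L : ℝ} (hc : 0 ≤ c) (hC : 0 ≤ C) (hL : 0 < L) (n : ℕ) {ε : ℝ}
    (hε : 0 < ε) :
    C * Real.exp (-(16 * 2 ^ d * c * n * rate d (2 * ε / L) ^ 2)) ≤ boundA d c C L n ε := by
  rw [boundA]
  refine mul_le_mul_of_nonneg_left ?_ hC
  have h2d : (1 : ℝ) ≤ 2 ^ d := one_le_pow₀ one_le_two
  unfold rate
  split_ifs with h3 h4
  · refine Real.exp_le_exp.2 (neg_le_neg ?_)
    have e : 16 * 2 ^ d * c * n * (2 * ε / L / 4) ^ 2 = 2 ^ d * (4 * c * n * ε ^ 2 / L ^ 2) := by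
      field_simp
      ring
    rw [e]
    exact le_mul_of_one_le_left (by positivity) h2d
  · refine Real.exp_le_exp.2 (neg_le_neg ?_)
    have e0 : 1 / (2 * ε / L) = L / (2 * ε) := one_div_div _ _
    rw [e0]
    have hlog : 0 < Real.log (2 + L / (2 * ε)) := by
      rw [← e0]
      exact log_two_add_inv_pos (by positivity)
    have e : 16 * 2 ^ d * c * n * (2 * ε / L / (4 * Real.log (2 + L / (2 * ε)))) ^ 2 =
        2 ^ d * (4 * c * n * ε ^ 2 / (L ^ 2 * Real.log (2 + L / (2 * ε)) ^ 2)) := by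
      field_simp
      ring
    rw [e]
    exact le_mul_of_one_le_left (by positivity) h2d
  · refine Real.exp_le_exp.2 (neg_le_neg ?_)
    rw [div_pow, Real.sq_sqrt (by positivity), ← Real.rpow_natCast _ 2, ← Real.rpow_mul (by positivity),
      show (d : ℝ) / 4 * (2 : ℕ) = d / 2 by push_cast; ring]
    have e : 16 * 2 ^ d * c * n * ((2 * ε / L) ^ ((d : ℝ) / 2) / 2 ^ d) =
        16 * (c * n * (2 * ε / L) ^ ((d : ℝ) / 2)) := by
      field_simp
    rw [e]
    exact le_mul_of_one_le_left (by positivity) (by norm_num)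

/-! ### Concentration within the shells -/

theorem sum_exp_le {a δ : ℝ} (ha : 1 ≤ a) (hδ : 0 < δ) (m : ℕ) :
    ∑ j ∈ Finset.range m, Real.exp (-(a * (1 + δ * j))) ≤
      (1 - Real.exp (-δ))⁻¹ * Real.exp (-a) := by
  have h1 : ∀ j : ℕ, Real.exp (-(a * (1 + δ * j))) ≤ Real.exp (-δ) ^ j * Real.exp (-a) := by
    intro j
    rw [← Real.exp_nat_mul, ← Real.exp_add]
    refine Real.exp_le_exp.2 ?_
    have : 0 ≤ δ * j := by positivity
    nlinarith
  calc _ ≤ ∑ j ∈ Finset.range m, Real.exp (-δ) ^ j * Real.exp (-a) :=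
        Finset.sum_le_sum fun j _ => h1 j
    _ = (∑ j ∈ Finset.range m, Real.exp (-δ) ^ j) * Real.exp (-a) := by rw [Finset.sum_mul]
    _ ≤ _ := by
        gcongr
        exact sum_pow_le_inv (Real.exp_pos _).le (Real.exp_lt_one_iff.2 (by linarith)) m

variable {d N : ℕ} {Ω : Type*} [MeasurableSpace Ω] {P : Measure Ω} [IsProbabilityMeasure P]
  {ξ : Fin N → Ω → Space d} {μ : Measure (Space d)} [IsProbabilityMeasure μ]

/-- At scale `j` the threshold is proportional to `p s b^j` with `b = √(2 ^ d)`, matching the growth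
of the noise with the number of cells, and the Bernstein parameter is `l = s b^j`. The exponents
then grow geometrically in `j`, and the scales can be summed. -/
theorem IsSample.shellBound_le (h : IsSample P ξ μ) (hN : 1 ≤ N) (hd : 1 ≤ d) {k m : ℕ}
    {p s : ℝ} (hp : μ.real (shell ⁻¹' {k}) ≤ p) (hs : 0 ≤ s)
    (hsm : s * √(2 ^ d) ^ m ≤ 1) (ha : 1 ≤ N * p * s ^ 2) :
    P.real {ω | (2 ^ d + 2) * p * (s * ∑ j ∈ Finset.range (m + 1), (√(2 ^ d) / 4) ^ j) + p / 4 ^ m <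
        shellBound (empiricalMeasure fun i => ξ i ω) μ k m} ≤
      (1 - Real.exp (-1))⁻¹ * Real.exp (-(N * p * s ^ 2)) := by
  set b := √((2 : ℝ) ^ d) with hb
  have hb1 : 1 ≤ b := one_le_sqrt_two_pow d
  have hb2 : b ^ 2 = 2 ^ d := Real.sq_sqrt (by positivity)
  set A : ℝ := 2 ^ d + 2 with hA
  set a := N * p * s ^ 2 with hadef
  have hsub : {ω | A * p * (s * ∑ j ∈ Finset.range (m + 1), (b / 4) ^ j) + p / 4 ^ m <
        shellBound (empiricalMeasure fun i => ξ i ω) μ k m} ⊆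
      ⋃ j ∈ Finset.range (m + 1), {ω | A * p * s * b ^ j ≤
        cellDev (empiricalMeasure fun i => ξ i ω) μ (shell ⁻¹' {k}) (cell k j) (cellBox d j)} := by
    intro ω hω
    simp only [Set.mem_ofPred_eq, shellBound] at hω
    have h1 : μ.real (shell ⁻¹' {k}) / 4 ^ m ≤ p / 4 ^ m := by gcongr
    have h2 : A * p * (s * ∑ j ∈ Finset.range (m + 1), (b / 4) ^ j) =
        ∑ j ∈ Finset.range (m + 1), A * p * s * b ^ j / 4 ^ j := by
      rw [Finset.mul_sum, Finset.mul_sum]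
      refine Finset.sum_congr rfl fun j _ => ?_
      rw [div_pow]
      ring
    rw [h2] at hω
    obtain ⟨j, hj, hlt⟩ := Finset.exists_lt_of_sum_lt (by linarith :
      ∑ j ∈ Finset.range (m + 1), A * p * s * b ^ j / 4 ^ j < ∑ j ∈ Finset.range (m + 1),
        shellDev (empiricalMeasure fun i => ξ i ω) μ k j / 4 ^ j)
    simp only [Set.mem_iUnion]
    exact ⟨j, hj, ((div_lt_div_iff_of_pos_right (by positivity)).1 hlt).le⟩
  have hj : ∀ j ∈ Finset.range (m + 1), P.real {ω | A * p * s * b ^ j ≤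
      cellDev (empiricalMeasure fun i => ξ i ω) μ (shell ⁻¹' {k}) (cell k j) (cellBox d j)} ≤
      Real.exp (-(a * (1 + 1 * j))) := by
    intro j hj
    have hjm : j ≤ m := Nat.lt_succ_iff.1 (Finset.mem_range.1 hj)
    have hl1 : s * b ^ j ≤ 1 := hsm.trans' (by gcongr)
    refine (h.cellDev_le hN (measurable_shell (measurableSet_singleton k)) (measurable_cell k j)
      (fun y hy => cell_mem_cellBox (norm_lt_of_mem_shell hy)) hp
      (l := s * b ^ j) (by positivity) hl1 _).trans ?_
    have hbj : (b ^ j) ^ 2 = (2 ^ d) ^ j := by rw [← pow_mul, mul_comm, pow_mul, hb2]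
    have e1 : N * ((s * b ^ j) ^ 2 * p - s * b ^ j * (A * p * s * b ^ j)) =
        a * ((2 : ℝ) ^ d) ^ j * (1 - A) := by
      rw [mul_pow, hbj, show s * b ^ j * (A * p * s * b ^ j) = A * p * s ^ 2 * (b ^ j) ^ 2 by ring,
        hbj, hadef]
      ring
    -- The entropy of the sign patterns. The constant `A = 2 ^ d + 2` is chosen so that, as `a ≥ 1`,
    -- this is absorbed and a decay `exp (-a (2 ^ d) ^ j)` is left.
    have e2 : (2 : ℝ) ^ (cellBox d j).card ≤ Real.exp (2 ^ d * (2 ^ d) ^ j) := by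
      have : (2 : ℝ) ≤ Real.exp 1 := by linarith [Real.add_one_le_exp (1 : ℝ)]
      calc (2 : ℝ) ^ (cellBox d j).card ≤ Real.exp 1 ^ (cellBox d j).card := by gcongr
        _ = Real.exp (2 ^ d * (2 ^ d) ^ j) := by
          rw [← Real.exp_nat_mul, card_cellBox]
          push_cast
          rw [mul_one]
    rw [e1]
    have hBj : (1 : ℝ) + 1 * j ≤ (2 ^ d) ^ j := by
      have h2 : (2 : ℝ) ≤ 2 ^ d := le_self_pow₀ one_le_two (by omega)
      have := one_add_mul_le_pow (a := (1 : ℝ)) (by norm_num) j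
      calc (1 : ℝ) + 1 * j ≤ (1 + 1) ^ j := by linarith
        _ ≤ (2 ^ d) ^ j := by gcongr; linarith
    have hA0 : (0 : ℝ) ≤ 2 ^ d * (2 ^ d) ^ j := by positivity
    calc _ ≤ Real.exp (2 ^ d * (2 ^ d) ^ j) * Real.exp (a * (2 ^ d) ^ j * (1 - A)) := by gcongr
      _ = Real.exp (2 ^ d * (2 ^ d) ^ j + a * (2 ^ d) ^ j * (1 - A)) := (Real.exp_add _ _).symm
      _ ≤ _ := by
        refine Real.exp_le_exp.2 ?_
        rw [hA]
        nlinarith [mul_le_mul_of_nonneg_left ha hA0,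
          mul_le_mul_of_nonneg_left hBj (by linarith : 0 ≤ a)]
  calc _ ≤ P.real (⋃ j ∈ Finset.range (m + 1), _) := measureReal_mono hsub (measure_ne_top _ _)
    _ ≤ _ := measureReal_biUnion_finset_le _ _
    _ ≤ _ := Finset.sum_le_sum hj
    _ ≤ _ := sum_exp_le ha one_pos _

/-! ### Reduction to the tails -/

section Tail

variable {d : ℕ}

/-- The squared norm, outside of the first `M` shells. -/
noncomputable def tailSq (M : ℕ) (y : Space d) : ℝ := if M ≤ shell y then ‖y‖ ^ 2 else 0

theorem tailSq_nonneg (M : ℕ) (y : Space d) : 0 ≤ tailSq M y := by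
  unfold tailSq
  split_ifs <;> positivity

theorem measurable_tailSq (M : ℕ) : Measurable (tailSq (d := d) M) :=
  Measurable.ite (measurable_shell measurableSet_Ici) (by fun_prop) measurable_const

theorem setLIntegral_eq_tailSq (M : ℕ) (ν : Measure (Space d)) :
    ∫⁻ x in {x | M ≤ shell x}, ENNReal.ofReal (‖x‖ ^ 2) ∂ν =
      ∫⁻ x, ENNReal.ofReal (tailSq M x) ∂ν := by
  have hM : MeasurableSet {x : Space d | M ≤ shell x} := measurable_shell measurableSet_Ici
  rw [← lintegral_indicator hM]
  refine lintegral_congr fun x => ?_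
  by_cases h : M ≤ shell x <;> simp [tailSq, h]

variable {N : ℕ} {Ω : Type*} [MeasurableSpace Ω] {P : Measure Ω} [IsProbabilityMeasure P]
  {ξ : Fin N → Ω → Space d} {μ : Measure (Space d)} [IsProbabilityMeasure μ]

theorem lintegral_tailSq_empiricalMeasure (hN : 1 ≤ N) (M : ℕ) (x : Fin N → Space d) :
    ∫⁻ y, ENNReal.ofReal (tailSq M y) ∂empiricalMeasure x =
      ENNReal.ofReal ((∑ i, tailSq M (x i)) / N) := by
  have hN0 : (0 : ℝ) < N := by positivity
  rw [lintegral_empiricalMeasure x (measurable_tailSq M).ennreal_ofReal,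
    ENNReal.ofReal_div_of_pos hN0, ENNReal.ofReal_sum_of_nonneg fun i _ => tailSq_nonneg M _,
    ENNReal.ofReal_natCast, ENNReal.div_eq_inv_mul]

/-- Deterministic bound in terms of the shells and the tail. -/
theorem exists_shellBound_lt_or (hN : 1 ≤ N) {x : ℝ} (hx : 0 < x) {M : ℕ} {m : ℕ → ℕ} {t : ℕ → ℝ}
    (hμ : ∫⁻ y, ENNReal.ofReal (tailSq M y) ∂μ ≤ ENNReal.ofReal (x / 8))
    (ht : ∑ k ∈ Finset.range M, (4 * d + 4) * 4 ^ k * t k ≤ x / 8) {z : Fin N → Space d}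
    (hz : ENNReal.ofReal x ≤ quadCost (empiricalMeasure z) μ) :
    (∃ k < M, t k < shellBound (empiricalMeasure z) μ k (m k)) ∨
      N * (x / 4) ≤ ∑ i, tailSq M (z i) := by
  by_contra! hcon
  obtain ⟨h1, h2⟩ := hcon
  have hN0 : (0 : ℝ) < N := by positivity
  have := isProbabilityMeasure_empiricalMeasure hN z
  have hq := quadCost_le (empiricalMeasure z) μ M m
  rw [setLIntegral_eq_tailSq, setLIntegral_eq_tailSq, lintegral_tailSq_empiricalMeasure hN] at hq
  have h3 : ∑ k ∈ Finset.range M, (4 * d + 4) * 4 ^ k * shellBound (empiricalMeasure z) μ k (m k) ≤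
      x / 8 := by
    refine le_trans (Finset.sum_le_sum fun k hk => ?_) ht
    gcongr
    exact h1 k (Finset.mem_range.1 hk)
  have h4 : (∑ i, tailSq M (z i)) / N < x / 4 := by
    rw [div_lt_iff₀ hN0]
    linarith
  have h5 : 0 ≤ (∑ i, tailSq M (z i)) / N :=
    div_nonneg (Finset.sum_nonneg fun i _ => tailSq_nonneg _ _) hN0.le
  have h6 : ENNReal.ofReal x ≤ ENNReal.ofReal
      (x / 8 + (2 * ((∑ i, tailSq M (z i)) / N) + 2 * (x / 8))) := by
    refine (hz.trans hq).trans ?_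
    rw [ENNReal.ofReal_add (by positivity) (by positivity), ENNReal.ofReal_add (by positivity)
      (by positivity), ENNReal.ofReal_mul zero_le_two, ENNReal.ofReal_mul zero_le_two,
      ENNReal.ofReal_ofNat]
    gcongr
  rw [ENNReal.ofReal_le_ofReal_iff (by positivity)] at h6
  linarith

theorem measureReal_le_mul_exp {s : Set Ω} {a C : ℝ} (ha : a < 1) (hC : Real.exp 1 ≤ C) :
    P.real s ≤ C * Real.exp (-a) := by
  calc P.real s ≤ 1 := measureReal_le_one
    _ = Real.exp 1 * Real.exp (-1) := by rw [← Real.exp_add]; simp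
    _ ≤ C * Real.exp (-a) :=
        mul_le_mul hC (Real.exp_le_exp.2 (by linarith)) (Real.exp_pos _).le
          ((Real.exp_pos 1).le.trans hC)

/-- Concentration up to the contribution of the tail. -/
theorem exists_quadCost_concentration (d : ℕ) (hd : 1 ≤ d) {β K : ℝ} (hβ : 1 < β) (hK : 1 ≤ K) :
    ∃ c C : ℝ, 0 < c ∧ 0 < C ∧
      ∀ (Ω : Type*) [MeasurableSpace Ω] (P : Measure Ω) [IsProbabilityMeasure P] (N : ℕ)
        (ξ : Fin N → Ω → Space d) (μ : Measure (Space d)) [IsProbabilityMeasure μ],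
        1 ≤ N → IsSample P ξ μ →
      ∀ (x : ℝ) (M : ℕ), 0 < x → (∀ k < M, x * (4 * β ^ 3) ^ k ≤ K) →
        (∀ k, μ.real (shell ⁻¹' {k}) ≤ K / (16 * β ^ 3) ^ k) →
        ∫⁻ y, ENNReal.ofReal (tailSq M y) ∂μ ≤ ENNReal.ofReal (x / 8) →
        P.real {ω | ENNReal.ofReal x ≤ quadCost (empiricalMeasure fun i => ξ i ω) μ} ≤
          C * Real.exp (-(c * N * rate d x ^ 2)) +
            P.real {ω | N * (x / 4) ≤ ∑ i, tailSq M (ξ i ω)} := by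
  have hβ0 : 0 < β := by linarith
  have hK0 : 0 < K := by linarith
  set D : ℝ := (4 * d + 4) * (5 * (2 ^ d + 2) + 1) with hD
  have h2d : (1 : ℝ) ≤ 2 ^ d := one_le_pow₀ one_le_two
  have hD1 : 1 ≤ D := by
    have : (0 : ℝ) ≤ d := by positivity
    nlinarith
  -- Chosen so that the geometric series of the errors of the shells sums to `x / 8`.
  set κ : ℝ := (1 - β⁻¹) / (8 * D) with hκ
  have hβi : β⁻¹ < 1 := inv_lt_one_of_one_lt₀ hβ
  have hβi0 : 0 < β⁻¹ := by positivity
  have hκ0 : 0 < κ := div_pos (by linarith) (by linarith)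
  have hκ1 : κ ≤ 1 := by
    rw [hκ, div_le_one (by linarith)]
    linarith
  obtain ⟨c₁, hc₁, hrate⟩ := exists_mul_rate_le d (κ := κ / K) (by positivity)
    ((div_le_one hK0).2 (by linarith))
  set G₁ : ℝ := (1 - Real.exp (-1))⁻¹ with hG₁
  set G₂ : ℝ := (1 - Real.exp (-(β - 1)))⁻¹ with hG₂
  have hG : ∀ δ : ℝ, 0 < δ → 1 ≤ (1 - Real.exp (-δ))⁻¹ := fun δ hδ => by
    have h1 : Real.exp (-δ) < 1 := Real.exp_lt_one_iff.2 (by linarith)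
    have h2 := Real.exp_pos (-δ)
    exact (one_le_inv₀ (by linarith)).2 (by linarith)
  have hG₁1 : 1 ≤ G₁ := hG 1 one_pos
  have hG₂1 : 1 ≤ G₂ := hG (β - 1) (by linarith)
  refine ⟨c₁ ^ 2, Real.exp 1 * (G₁ * G₂), by positivity, by positivity, ?_⟩
  intro Ω _ P _ N ξ μ _ hN h x M hx hxM hshell htail
  set a : ℝ := c₁ ^ 2 * N * rate d x ^ 2 with ha
  have hG12 : 1 ≤ G₁ * G₂ := one_le_mul_of_one_le_of_one_le hG₁1 hG₂1
  -- If the exponent is below `1`, the bound exceeds `1`, because the constant is at least `e`.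
  rcases lt_or_ge a 1 with ha1 | ha1
  · exact (measureReal_le_mul_exp ha1 (le_mul_of_one_le_right (Real.exp_pos _).le hG12)).trans
      (le_add_of_nonneg_right measureReal_nonneg)
  set p : ℕ → ℝ := fun k => K / (16 * β ^ 3) ^ k with hp
  -- The balance between shells. With this accuracy `4^k p_k y_k` decays like `β^(-k)`, while `p_k
  -- (rate d (y_k))²` is at least of order `β^k (rate d x)²` by `mul_rate_le`. Both are possible
  -- because the shell masses decay faster than `16^(-k)`.
  set y : ℕ → ℝ := fun k => κ / K * x * (4 * β ^ 2) ^ k with hy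
  have hy0 : ∀ k, 0 < y k := fun k => by positivity
  have hβk : ∀ k : ℕ, 1 ≤ β ^ k := fun k => one_le_pow₀ hβ.le
  have hy1 : ∀ k < M, y k ≤ 1 := by
    intro k hk
    have h1 : x * (4 * β ^ 2) ^ k ≤ K := by
      refine le_trans ?_ (hxM k hk)
      gcongr
      · exact hβ.le
      · norm_num
    calc y k = κ * (x * (4 * β ^ 2) ^ k) / K := by rw [hy]; ring
      _ ≤ 1 * K / K := by gcongr
      _ = 1 := by rw [one_mul, div_self hK0.ne']
  have hpy : ∀ k, p k * y k = κ * x / (4 * β) ^ k := by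
    intro k
    have e : ((16 : ℝ) * β ^ 3) ^ k = (4 * β ^ 2) ^ k * (4 * β) ^ k := by
      rw [← mul_pow]
      ring
    rw [hp, hy]
    simp only
    rw [e]
    field_simp
  have hs : ∀ k, a * (1 + (β - 1) * k) ≤ N * p k * rate d (y k) ^ 2 := by
    intro k
    have h1 : c₁ * rate d x * (4 * β ^ 2) ^ k ≤ rate d (y k) := by
      have h2 := hrate x hx
      have h3 := mul_rate_le d (l := (4 * β ^ 2) ^ k) (y := κ / K * x)
        (one_le_pow₀ (by nlinarith)) (by positivity)
      rw [mul_comm (_ ^ k) (κ / K * x)] at h3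
      refine le_trans ?_ h3
      rw [mul_comm]
      gcongr
    have hr0 := rate_pos d hx
    have h4 : (c₁ * rate d x * (4 * β ^ 2) ^ k) ^ 2 ≤ rate d (y k) ^ 2 := by gcongr
    have e : ((4 : ℝ) * β ^ 2) ^ k * (4 * β ^ 2) ^ k = (16 * β ^ 3) ^ k * β ^ k := by
      rw [← mul_pow, ← mul_pow]
      ring
    have hb : 1 + (β - 1) * k ≤ β ^ k := by
      have := one_add_mul_le_pow (a := β - 1) (by linarith) k
      rw [add_sub_cancel] at this
      linarith
    calc a * (1 + (β - 1) * k) ≤ a * β ^ k := by gcongr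
      _ = N * (1 / (16 * β ^ 3) ^ k) * (c₁ * rate d x * (4 * β ^ 2) ^ k) ^ 2 := by
        rw [mul_pow _ ((4 * β ^ 2) ^ k) 2, pow_two ((4 * β ^ 2) ^ k), e, ha]
        field_simp
      _ ≤ N * p k * rate d (y k) ^ 2 := by
        rw [hp]
        simp only
        gcongr
  have hs1 : ∀ k, 1 ≤ N * p k * rate d (y k) ^ 2 := by
    intro k
    refine le_trans ?_ (hs k)
    have : 0 ≤ (β - 1) * k := mul_nonneg (by linarith) (by positivity)
    nlinarith
  have hscale : ∀ k, ∃ m : ℕ, k < M → 1 / 4 ^ m ≤ y k ∧ rate d (y k) * √(2 ^ d) ^ m ≤ 1 ∧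
      rate d (y k) * ∑ j ∈ Finset.range (m + 1), (√(2 ^ d) / 4) ^ j ≤ 5 * y k := by
    intro k
    by_cases hk : k < M
    · obtain ⟨m, hm⟩ := exists_scale d (hy0 k) (hy1 k hk)
      exact ⟨m, fun _ => hm⟩
    · exact ⟨0, fun hk' => absurd hk' hk⟩
  choose m hm using hscale
  set t : ℕ → ℝ := fun k => (2 ^ d + 2) * p k *
    (rate d (y k) * ∑ j ∈ Finset.range (m k + 1), (√(2 ^ d) / 4) ^ j) + p k / 4 ^ m k with ht
  have htsum : ∑ k ∈ Finset.range M, (4 * d + 4) * 4 ^ k * t k ≤ x / 8 := by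
    have h1 : ∀ k ∈ Finset.range M, (4 * d + 4) * 4 ^ k * t k ≤ D * κ * x * β⁻¹ ^ k := by
      intro k hk
      obtain ⟨hm1, -, hm3⟩ := hm k (Finset.mem_range.1 hk)
      have hpk : 0 ≤ p k := by positivity
      have h2 : t k ≤ (5 * (2 ^ d + 2) + 1) * (p k * y k) := by
        calc t k = (2 ^ d + 2) * p k * (rate d (y k) *
              ∑ j ∈ Finset.range (m k + 1), (√(2 ^ d) / 4) ^ j) + p k * (1 / 4 ^ m k) := by
              rw [ht]; ring
          _ ≤ (2 ^ d + 2) * p k * (5 * y k) + p k * y k := by gcongr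
          _ = _ := by ring
      rw [hpy] at h2
      calc _ ≤ (4 * d + 4) * 4 ^ k * ((5 * (2 ^ d + 2) + 1) * (κ * x / (4 * β) ^ k)) := by gcongr
        _ = _ := by
          rw [hD, mul_pow, inv_pow]
          field_simp
    calc _ ≤ ∑ k ∈ Finset.range M, D * κ * x * β⁻¹ ^ k := Finset.sum_le_sum h1
      _ = D * κ * x * ∑ k ∈ Finset.range M, β⁻¹ ^ k := by rw [Finset.mul_sum]
      _ ≤ D * κ * x * (1 - β⁻¹)⁻¹ := by
        gcongr
        exact sum_pow_le_inv hβi0.le hβi M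
      _ = x / 8 := by
        have h2 : 1 - β⁻¹ ≠ 0 := (sub_pos.2 hβi).ne'
        rw [hκ]
        generalize 1 - β⁻¹ = w at h2
        field_simp
  have hsub : {ω | ENNReal.ofReal x ≤ quadCost (empiricalMeasure fun i => ξ i ω) μ} ⊆
      (⋃ k ∈ Finset.range M,
        {ω | t k < shellBound (empiricalMeasure fun i => ξ i ω) μ k (m k)}) ∪
      {ω | N * (x / 4) ≤ ∑ i, tailSq M (ξ i ω)} := by
    intro ω hω
    rcases exists_shellBound_lt_or (m := m) hN hx htail htsum hω with ⟨k, hk, hlt⟩ | hT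
    · left
      simp only [Set.mem_iUnion]
      exact ⟨k, Finset.mem_range.2 hk, hlt⟩
    · exact Or.inr hT
  refine (measureReal_mono hsub (measure_ne_top _ _)).trans
    ((measureReal_union_le _ _).trans (add_le_add_left ?_ _))
  calc _ ≤ ∑ k ∈ Finset.range M,
        P.real {ω | t k < shellBound (empiricalMeasure fun i => ξ i ω) μ k (m k)} :=
        measureReal_biUnion_finset_le _ _
    _ ≤ ∑ k ∈ Finset.range M, G₁ * Real.exp (-(a * (1 + (β - 1) * k))) := by
        refine Finset.sum_le_sum fun k hk => ?_
        obtain ⟨-, hm2, -⟩ := hm k (Finset.mem_range.1 hk)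
        refine (h.shellBound_le hN hd (hshell k) (rate_pos d (hy0 k)).le hm2 (hs1 k)).trans ?_
        exact mul_le_mul_of_nonneg_left (Real.exp_le_exp.2 (neg_le_neg (hs k))) (by positivity)
    _ = G₁ * ∑ k ∈ Finset.range M, Real.exp (-(a * (1 + (β - 1) * k))) := by rw [Finset.mul_sum]
    _ ≤ G₁ * (G₂ * Real.exp (-a)) := by
        gcongr
        exact sum_exp_le ha1 (by linarith) M
    _ ≤ Real.exp 1 * (G₁ * G₂) * Real.exp (-a) := by
        have : (1 : ℝ) ≤ Real.exp 1 := Real.one_le_exp zero_le_one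
        have h2 : 0 ≤ G₁ * G₂ * Real.exp (-a) := by positivity
        nlinarith

end Tail

/-! ### Deviations of the tail -/

section TailDeviation

variable {d : ℕ} {μ : Measure (Space d)}

theorem real_ge_le_of_lintegral_le {f : Space d → ℝ} (hf : Measurable f) {b c : ℝ} (hb : 0 ≤ b)
    (hc : 0 < c) (h : ∫⁻ y, ENNReal.ofReal (f y) ∂μ ≤ ENNReal.ofReal b) :
    μ.real {y | c ≤ f y} ≤ b / c := by
  have h1 := meas_ge_le_lintegral_div (μ := μ) hf.ennreal_ofReal.aemeasurable
    (ε := ENNReal.ofReal c) (by simpa using hc) ENNReal.ofReal_ne_top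
  refine ENNReal.toReal_le_of_le_ofReal (by positivity) ?_
  rw [ENNReal.ofReal_div_of_pos hc]
  refine (measure_mono fun y hy => ?_).trans (h1.trans (ENNReal.div_le_div_right h _))
  exact ENNReal.ofReal_le_ofReal hy

theorem lintegral_exp_le [IsProbabilityMeasure μ] {f h : Space d → ℝ} (hh : ∀ y, 0 ≤ h y)
    (hfh : ∀ y, Real.exp (f y) ≤ 1 + h y) {b : ℝ} (hb : 0 ≤ b)
    (hint : ∫⁻ y, ENNReal.ofReal (h y) ∂μ ≤ ENNReal.ofReal b) :
    ∫⁻ y, ENNReal.ofReal (Real.exp (f y)) ∂μ ≤ ENNReal.ofReal (Real.exp b) := by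
  calc _ ≤ ∫⁻ y, (1 + ENNReal.ofReal (h y)) ∂μ := by
        refine lintegral_mono fun y => ?_
        rw [← ENNReal.ofReal_one, ← ENNReal.ofReal_add zero_le_one (hh y)]
        exact ENNReal.ofReal_le_ofReal (hfh y)
    _ = 1 + ∫⁻ y, ENNReal.ofReal (h y) ∂μ := by
        rw [lintegral_add_left measurable_const]
        simp
    _ ≤ ENNReal.ofReal (1 + b) := by
        rw [ENNReal.ofReal_add zero_le_one hb, ENNReal.ofReal_one]
        gcongr
    _ ≤ _ := ENNReal.ofReal_le_ofReal (by linarith [Real.add_one_le_exp b])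

theorem exp_le_one_add_mul_exp (t : ℝ) : Real.exp t ≤ 1 + t * Real.exp t := by
  have h1 := Real.add_one_le_exp (-t)
  have h2 : Real.exp (-t) * Real.exp t = 1 := by rw [← Real.exp_add]; simp
  nlinarith [Real.exp_pos t]

theorem tailSq_le (M : ℕ) (y : Space d) : tailSq M y ≤ ‖y‖ ^ 2 := by
  unfold tailSq
  split_ifs
  · exact le_rfl
  · positivity

theorem lintegral_ofReal_const_mul_le {h : Space d → ℝ} {b c : ℝ} (hc : 0 ≤ c)
    (hint : ∫⁻ y, ENNReal.ofReal (h y) ∂μ ≤ ENNReal.ofReal b) :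
    ∫⁻ y, ENNReal.ofReal (c * h y) ∂μ ≤ ENNReal.ofReal (c * b) := by
  simp only [ENNReal.ofReal_mul hc]
  rw [lintegral_const_mul' _ _ ENNReal.ofReal_ne_top]
  gcongr

variable {N : ℕ} {Ω : Type*} [MeasurableSpace Ω] {P : Measure Ω}
  {ξ : Fin N → Ω → Space d}

/-- By `exp t ≤ 1 + t exp t` the logarithmic moment generating function of `tailSq M` at `1` is at
most `x / 8`, half of the threshold `x / 4`. -/
theorem IsSample.tail_subgaussian [IsProbabilityMeasure μ] (h : IsSample P ξ μ) {x : ℝ} (hx : 0 < x) {M : ℕ}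
    (hint : ∫⁻ y, ENNReal.ofReal (tailSq M y * Real.exp (‖y‖ ^ 2)) ∂μ ≤ ENNReal.ofReal (x / 8)) :
    P.real {ω | N * (x / 4) ≤ ∑ i, tailSq M (ξ i ω)} ≤ Real.exp (-(N * x / 8)) := by
  refine (h.chernoff (measurable_tailSq M) (lintegral_exp_le (h := fun y => tailSq M y *
    Real.exp (‖y‖ ^ 2)) (fun y => mul_nonneg (tailSq_nonneg M y) (Real.exp_pos _).le)
    (fun y => ?_) (by positivity) hint) (x / 4)).trans (Real.exp_le_exp.2 (by linarith))
  refine (exp_le_one_add_mul_exp _).trans ?_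
  have := tailSq_nonneg M y
  gcongr
  exact tailSq_le M y

/-- By Jensen's inequality a large mean of `‖ξ i‖²` forces a large mean of `‖ξ i‖^α`, to which
Chernoff's inequality applies. For large `x` the constant `a` costs at most half of the exponent. -/
theorem IsSample.tail_expHigh (h : IsSample P ξ μ) (hN : 1 ≤ N) {α γ a : ℝ} (hα : 2 < α)
    (hγ : 0 < γ) (ha : expMoment α γ μ ≤ ENNReal.ofReal (Real.exp a)) {x : ℝ} (hx : 0 < x)
    (hax : 2 * a ≤ γ * (x / 4) ^ (α / 2)) (M : ℕ) [IsFiniteMeasure P] :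
    P.real {ω | N * (x / 4) ≤ ∑ i, tailSq M (ξ i ω)} ≤
      Real.exp (-(γ / 2 * N * (x / 4) ^ (α / 2))) := by
  have hN0 : (0 : ℝ) < N := by positivity
  have h1 := h.chernoff (f := fun y => γ * ‖y‖ ^ α) (by fun_prop) ha (γ * (x / 4) ^ (α / 2))
  refine (measureReal_mono (fun ω hω => ?_) (measure_ne_top _ _)).trans (h1.trans ?_)
  · simp only [Set.mem_ofPred_eq] at hω ⊢
    have h2 := Real.rpow_arith_mean_le_arith_mean_rpow Finset.univ (fun _ : Fin N => (N : ℝ)⁻¹)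
      (fun i => ‖ξ i ω‖ ^ 2) (fun _ _ => by positivity) (by simp [hN0.ne'])
      (fun _ _ => by positivity) (p := α / 2) (by linarith)
    simp only [← Finset.mul_sum] at h2
    have h3 : x / 4 ≤ (N : ℝ)⁻¹ * ∑ i, ‖ξ i ω‖ ^ 2 := by
      rw [inv_mul_eq_div, le_div_iff₀ hN0, mul_comm]
      exact hω.trans (Finset.sum_le_sum fun i _ => tailSq_le M _)
    have h4 : ∀ i, (‖ξ i ω‖ ^ 2) ^ (α / 2) = ‖ξ i ω‖ ^ α := fun i => by
      rw [← Real.rpow_natCast, ← Real.rpow_mul (norm_nonneg _)]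
      congr 1
      push_cast
      ring
    simp only [h4] at h2
    have h5 : (x / 4) ^ (α / 2) ≤ (N : ℝ)⁻¹ * ∑ i, ‖ξ i ω‖ ^ α :=
      (Real.rpow_le_rpow (by positivity) h3 (by linarith)).trans h2
    rw [inv_mul_eq_div, le_div_iff₀ hN0] at h5
    rw [← Finset.mul_sum]
    nlinarith
  · refine Real.exp_le_exp.2 ?_
    nlinarith

theorem IsSample.tail_expLow [IsProbabilityMeasure P] [IsProbabilityMeasure μ]
    (h : IsSample P ξ μ) (hN : 1 ≤ N) {α γ K : ℝ} (hα0 : 0 < α)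
    (hα : α < 2) (hγ : 0 < γ) (hK : 0 ≤ K) (hmom : expMoment α γ μ ≤ ENNReal.ofReal K)
    {x : ℝ} (hx : 0 < x) {M : ℕ}
    (hint : ∫⁻ y, ENNReal.ofReal (tailSq M y * Real.exp (γ / 2 * ‖y‖ ^ α)) ∂μ ≤
      ENNReal.ofReal (x / 8)) :
    P.real {ω | N * (x / 4) ≤ ∑ i, tailSq M (ξ i ω)} ≤
      Real.exp (-(γ / 16 * (N * x) ^ (α / 2))) +
        N * (K * Real.exp (-(γ * (N * x) ^ (α / 2)))) := by
  have hN0 : (0 : ℝ) < N := by positivity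
  set z : ℝ := N * x with hz
  have hz0 : 0 < z := by positivity
  -- The largest parameter for which `l ‖y‖² ≤ (γ / 2) ‖y‖^α` on the whole truncated range `‖y‖² ≤
  -- z`; it uses `α < 2`. Larger observations are left to the union bound.
  set l : ℝ := γ / 2 * z ^ (α / 2 - 1) with hl
  have hl0 : 0 < l := by positivity
  have hnorm : ∀ y : Space d, (‖y‖ ^ 2) ^ (α / 2) = ‖y‖ ^ α := fun y => by
    rw [← Real.rpow_natCast, ← Real.rpow_mul (norm_nonneg _)]
    congr 1
    push_cast
    ring
  set f : Space d → ℝ := fun y => if ‖y‖ ^ 2 ≤ z then l * tailSq M y else 0 with hf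
  have hfm : Measurable f := Measurable.ite
    (measurableSet_le (by fun_prop) measurable_const) ((measurable_tailSq M).const_mul l)
    measurable_const
  have hexp : ∀ y, Real.exp (f y) ≤ 1 + l * (tailSq M y * Real.exp (γ / 2 * ‖y‖ ^ α)) := by
    intro y
    have h0 := tailSq_nonneg M y
    simp only [hf]
    split_ifs with hy
    · refine (exp_le_one_add_mul_exp _).trans ?_
      rw [mul_assoc]
      have h1 : l * tailSq M y ≤ γ / 2 * ‖y‖ ^ α := by
        refine (mul_le_mul_of_nonneg_left (tailSq_le M y) hl0.le).trans ?_
        rw [hl, mul_assoc]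
        refine mul_le_mul_of_nonneg_left ?_ (by positivity)
        rw [← hnorm]
        rcases (sq_nonneg ‖y‖).eq_or_lt with h2 | h2
        · rw [← h2, mul_zero]
          positivity
        · calc z ^ (α / 2 - 1) * ‖y‖ ^ 2 ≤ (‖y‖ ^ 2) ^ (α / 2 - 1) * ‖y‖ ^ 2 := by
                refine mul_le_mul_of_nonneg_right ?_ h2.le
                exact Real.rpow_le_rpow_of_nonpos h2 hy (by linarith)
            _ = _ := by rw [Real.rpow_sub_one h2.ne', div_mul_cancel₀ _ h2.ne']
      gcongr
    · simp only [Real.exp_zero]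
      have : 0 ≤ l * (tailSq M y * Real.exp (γ / 2 * ‖y‖ ^ α)) := by positivity
      linarith
  have hch := h.chernoff hfm (lintegral_exp_le (fun y => mul_nonneg hl0.le
    (mul_nonneg (tailSq_nonneg M y) (Real.exp_pos _).le)) hexp (by positivity)
    (lintegral_ofReal_const_mul_le hl0.le hint)) (l * (x / 4))
  set A : Set (Space d) := {y | Real.exp (γ * z ^ (α / 2)) ≤ Real.exp (γ * ‖y‖ ^ α)} with hA
  have hexpm : Measurable fun y : Space d => Real.exp (γ * ‖y‖ ^ α) := by fun_prop
  have hAm : MeasurableSet A := measurableSet_le measurable_const hexpm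
  have hAμ : μ.real A ≤ K * Real.exp (-(γ * z ^ (α / 2))) := by
    rw [Real.exp_neg, ← div_eq_mul_inv]
    exact real_ge_le_of_lintegral_le hexpm hK (Real.exp_pos _) hmom
  have hsub : {ω | N * (x / 4) ≤ ∑ i, tailSq M (ξ i ω)} ⊆
      {ω | N * (l * (x / 4)) ≤ ∑ i, f (ξ i ω)} ∪ {ω | ∃ i, ξ i ω ∈ A} := by
    intro ω hω
    by_cases hex : ∃ i, ξ i ω ∈ A
    · exact Or.inr hex
    · left
      simp only [Set.mem_ofPred_eq] at hω ⊢
      have h1 : ∀ i, f (ξ i ω) = l * tailSq M (ξ i ω) := by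
        intro i
        have h2 : ‖ξ i ω‖ ^ 2 ≤ z := by
          by_contra hcon
          refine hex ⟨i, Real.exp_le_exp.2 (mul_le_mul_of_nonneg_left ?_ hγ.le)⟩
          rw [← hnorm]
          exact Real.rpow_le_rpow hz0.le (not_le.1 hcon).le (by positivity)
        simp [hf, h2]
      simp only [h1, ← Finset.mul_sum]
      nlinarith [mul_le_mul_of_nonneg_left hω hl0.le]
  have hlz : N * (l * (x / 8) - l * (x / 4)) = -(γ / 16 * z ^ (α / 2)) := by
    have : z ^ (α / 2) = z ^ (α / 2 - 1) * z := by
      rw [Real.rpow_sub_one hz0.ne', div_mul_cancel₀ _ hz0.ne']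
    rw [this, hl, hz]
    ring
  rw [hlz] at hch
  refine (measureReal_mono hsub (measure_ne_top _ _)).trans ((measureReal_union_le _ _).trans
    (add_le_add hch ((h.real_exists_mem_le hAm).trans ?_)))
  gcongr

theorem log_rpow_mul_rpow_le {q : ℝ} (hq : 4 < q) {z : ℝ} (hz : 1 ≤ z) :
    z ^ (2 + (q - 4) / 8 - q / 2) * Real.log z ^ (q / 2) ≤ ((q - 4) / (4 * q))⁻¹ ^ (q / 2) := by
  have hz0 : 0 < z := by linarith
  set ε := (q - 4) / (4 * q) with hε
  have hε0 : 0 < ε := div_pos (by linarith) (by linarith)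
  have h1 : Real.log z ≤ z ^ ε / ε := Real.log_le_rpow_div hz0.le hε0
  have h2 : Real.log z ^ (q / 2) ≤ (z ^ ε / ε) ^ (q / 2) :=
    Real.rpow_le_rpow (Real.log_nonneg hz) h1 (by linarith)
  calc _ ≤ z ^ (2 + (q - 4) / 8 - q / 2) * (z ^ ε / ε) ^ (q / 2) := by gcongr
    _ = z ^ (-((q - 4) / 4)) * ε⁻¹ ^ (q / 2) := by
      rw [div_eq_mul_inv (z ^ ε), Real.mul_rpow (by positivity) (by positivity), ← mul_assoc,
        ← Real.rpow_mul hz0.le, ← Real.rpow_add hz0]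
      congr 2
      have : q ≠ 0 := by linarith
      rw [hε]
      field_simp
      ring
    _ ≤ 1 * ε⁻¹ ^ (q / 2) := by
      gcongr
      exact Real.rpow_le_one_of_one_le_of_nonpos hz (by linarith)
    _ = _ := one_mul _

theorem exp_le_one_add_rpow {t z r p : ℝ} (ht : 0 ≤ t) (hz : 1 ≤ z) (hp : 0 ≤ p)
    (htz : t ≤ r * Real.log z) : Real.exp t ≤ 1 + (4 * t + z ^ r * t ^ p) := by
  have hz0 : 0 < z := by linarith
  rcases le_or_gt t 1 with h1 | h1
  · have h2 : t ^ 2 ≤ t := by nlinarith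
    have h3 := exp_le_one_add_add_sq (abs_le.2 ⟨by linarith, h1⟩)
    have : 0 ≤ z ^ r * t ^ p := by positivity
    linarith
  · have h2 : Real.exp t ≤ z ^ r := by
      rw [Real.rpow_def_of_pos hz0, mul_comm]
      exact Real.exp_le_exp.2 htz
    have h3 : 1 ≤ t ^ p := Real.one_le_rpow h1.le hp
    have h4 : 0 ≤ z ^ r := by positivity
    nlinarith

/-- A truncation argument of Fuk–Nagaev type: observations with `‖y‖² ≥ z / A`, where `z = N x`, are
left to Markov's inequality and the union bound. The others have exponential moments growing at most
like a small power of `z`. -/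
theorem exists_tail_power {q K : ℝ} (hq : 4 < q) (hK : 0 ≤ K) :
    ∃ C : ℝ, 0 < C ∧ ∀ {d : ℕ} (Ω : Type*) [MeasurableSpace Ω] (P : Measure Ω)
      [IsProbabilityMeasure P] (N : ℕ) (ξ : Fin N → Ω → Space d) (μ : Measure (Space d))
      [IsProbabilityMeasure μ], 1 ≤ N → IsSample P ξ μ → powerMoment q μ ≤ ENNReal.ofReal K →
      ∀ (x : ℝ) (M : ℕ), 0 < x → 1 ≤ N * x ^ 2 →
        ∫⁻ y, ENNReal.ofReal (tailSq M y) ∂μ ≤ ENNReal.ofReal (x / 32) →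
        P.real {ω | N * (x / 4) ≤ ∑ i, tailSq M (ξ i ω)} ≤ C * (N * (N * x) ^ (-(q / 2))) := by
  set r : ℝ := (q - 4) / 8 with hr
  have hr0 : 0 < r := by rw [hr]; linarith
  have hq0 : 0 < q := by linarith
  set A : ℝ := 4 * q / r with hA
  have hA0 : 0 < A := by positivity
  set B : ℝ := K * ((4 * q) ^ (q / 2) * ((q - 4) / (4 * q))⁻¹ ^ (q / 2)) with hB
  have hεn : 0 ≤ (q - 4) / (4 * q) := div_nonneg (by linarith) (by linarith)
  have hB0 : 0 ≤ B := by positivity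
  refine ⟨Real.exp (q / 2) + Real.exp B + K * A ^ (q / 2), by positivity, ?_⟩
  intro d Ω _ P _ N ξ μ _ hN h hmom x M hx hNx hint
  have hN0 : (0 : ℝ) < N := by positivity
  have hN1 : (1 : ℝ) ≤ N := by exact_mod_cast hN
  set z : ℝ := N * x with hz
  have hz0 : 0 < z := by positivity
  rcases lt_or_ge z (Real.exp 1) with hze | hze
  · have h1 : Real.exp (-(q / 2)) ≤ z ^ (-(q / 2)) := by
      calc Real.exp (-(q / 2)) = Real.exp 1 ^ (-(q / 2)) := by rw [← Real.exp_mul, one_mul]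
        _ ≤ z ^ (-(q / 2)) := Real.rpow_le_rpow_of_nonpos hz0 hze.le (by linarith)
    calc P.real _ ≤ 1 := measureReal_le_one
      _ = Real.exp (q / 2) * (1 * Real.exp (-(q / 2))) := by
        rw [one_mul, ← Real.exp_add]
        simp
      _ ≤ _ := by
        gcongr
        rw [add_assoc]
        exact le_add_of_nonneg_right (by positivity)
  have hz1 : 1 ≤ z := (Real.one_le_exp zero_le_one).trans hze
  have hlog : 1 ≤ Real.log z := (Real.le_log_iff_exp_le hz0).2 hze
  -- The linear part of the Chernoff exponent is then `-l z / 8 = -(q / 2) log z`, exactly the power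
  -- required. The choice of `A` gives `l ‖y‖² ≤ r log z` below the truncation level.
  set l : ℝ := 4 * q * Real.log z / z with hl
  have hl0 : 0 < l := by positivity
  have hlA : l * (z / A) = r * Real.log z := by
    rw [hl, hA]
    field_simp
  set f : Space d → ℝ := fun y => if ‖y‖ ^ 2 < z / A then l * tailSq M y else 0 with hf
  have hfm : Measurable f := Measurable.ite
    (measurableSet_lt (by fun_prop) measurable_const) ((measurable_tailSq M).const_mul l)
    measurable_const
  have hnorm : ∀ y : Space d, (‖y‖ ^ 2) ^ (q / 2) = ‖y‖ ^ q := fun y => by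
    rw [← Real.rpow_natCast, ← Real.rpow_mul (norm_nonneg _)]
    congr 1
    push_cast
    ring
  have hexp : ∀ y, Real.exp (f y) ≤
      1 + (4 * l * tailSq M y + z ^ r * l ^ (q / 2) * ‖y‖ ^ q) := by
    intro y
    have h0 := tailSq_nonneg M y
    simp only [hf]
    split_ifs with hy
    · have h1 : l * tailSq M y ≤ r * Real.log z := by
        rw [← hlA]
        gcongr
        exact (tailSq_le M y).trans hy.le
      refine (exp_le_one_add_rpow (p := q / 2) (by positivity) hz1 (by positivity) h1).trans ?_
      rw [Real.mul_rpow hl0.le h0, ← mul_assoc, ← mul_assoc, ← hnorm]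
      gcongr
      exact tailSq_le M y
    · rw [Real.exp_zero]
      exact le_add_of_nonneg_right (by positivity)
  have hm2 : Measurable fun y : Space d => ENNReal.ofReal (4 * l * tailSq M y) :=
    ((measurable_tailSq M).const_mul _).ennreal_ofReal
  have hint2 : ∫⁻ y, ENNReal.ofReal (4 * l * tailSq M y + z ^ r * l ^ (q / 2) * ‖y‖ ^ q) ∂μ ≤
      ENNReal.ofReal (4 * l * (x / 32) + z ^ r * l ^ (q / 2) * K) := by
    have e : ∀ y : Space d, ENNReal.ofReal (4 * l * tailSq M y + z ^ r * l ^ (q / 2) * ‖y‖ ^ q) =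
        ENNReal.ofReal (4 * l * tailSq M y) + ENNReal.ofReal (z ^ r * l ^ (q / 2) * ‖y‖ ^ q) :=
      fun y => ENNReal.ofReal_add (mul_nonneg (by positivity) (tailSq_nonneg M y)) (by positivity)
    simp only [e]
    rw [lintegral_add_left hm2, ENNReal.ofReal_add (by positivity) (by positivity)]
    exact add_le_add (lintegral_ofReal_const_mul_le (by positivity) hint)
      (lintegral_ofReal_const_mul_le (by positivity) hmom)
  have hch := h.chernoff hfm (lintegral_exp_le (fun y => add_nonneg
    (mul_nonneg (by positivity) (tailSq_nonneg M y)) (by positivity)) hexp (by positivity) hint2)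
    (l * (x / 4))
  have hNz : (N : ℝ) ≤ z ^ (2 : ℝ) := by
    rw [hz, Real.rpow_two, mul_pow]
    nlinarith
  -- The remainder is bounded: by `N ≤ z²` its power of `z` is `2 + r - q/2`, which is negative
  -- since `q > 4` and `r = (q - 4) / 8`, and the power of `log z` is absorbed.
  have hmain : N * (z ^ r * l ^ (q / 2) * K) ≤ B := by
    have e1 : l ^ (q / 2) = (4 * q) ^ (q / 2) * Real.log z ^ (q / 2) * z ^ (-(q / 2)) := by
      rw [hl, Real.div_rpow (by positivity) hz0.le, Real.mul_rpow (by positivity) (by linarith),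
        Real.rpow_neg hz0.le, div_eq_mul_inv]
    have e2 : z ^ (2 + (q - 4) / 8 - q / 2) = z ^ (2 : ℝ) * z ^ r * z ^ (-(q / 2)) := by
      rw [← Real.rpow_add hz0, ← Real.rpow_add hz0, hr, sub_eq_add_neg]
    have h1 := log_rpow_mul_rpow_le hq hz1
    rw [e2] at h1
    calc _ ≤ z ^ (2 : ℝ) * (z ^ r * l ^ (q / 2) * K) := by gcongr
      _ = K * ((4 * q) ^ (q / 2) *
          (z ^ (2 : ℝ) * z ^ r * z ^ (-(q / 2)) * Real.log z ^ (q / 2))) := by rw [e1]; ring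
      _ ≤ B := by
        rw [hB]
        gcongr
  have hexpo : Real.exp (N * (4 * l * (x / 32) + z ^ r * l ^ (q / 2) * K - l * (x / 4))) ≤
      Real.exp B * z ^ (-(q / 2)) := by
    rw [Real.rpow_def_of_pos hz0 (-(q / 2)), ← Real.exp_add]
    refine Real.exp_le_exp.2 ?_
    have e1 : l * z = 4 * q * Real.log z := by
      rw [hl, div_mul_cancel₀ _ hz0.ne']
    have e2 : (N : ℝ) * (4 * l * (x / 32) + z ^ r * l ^ (q / 2) * K - l * (x / 4)) =
        N * (z ^ r * l ^ (q / 2) * K) - l * z / 8 := by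
      rw [hz]
      ring
    rw [e2, e1]
    linarith
  set S : Set (Space d) := {y | (z / A) ^ (q / 2) ≤ ‖y‖ ^ q} with hS
  have hqm : Measurable fun y : Space d => ‖y‖ ^ q := by fun_prop
  have hSm : MeasurableSet S := measurableSet_le measurable_const hqm
  have hSμ : μ.real S ≤ K * A ^ (q / 2) * z ^ (-(q / 2)) := by
    refine (real_ge_le_of_lintegral_le hqm hK (by positivity) hmom).trans_eq ?_
    rw [Real.div_rpow hz0.le hA0.le, Real.rpow_neg hz0.le]
    field_simp
  have hsub : {ω | N * (x / 4) ≤ ∑ i, tailSq M (ξ i ω)} ⊆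
      {ω | N * (l * (x / 4)) ≤ ∑ i, f (ξ i ω)} ∪ {ω | ∃ i, ξ i ω ∈ S} := by
    intro ω hω
    by_cases hex : ∃ i, ξ i ω ∈ S
    · exact Or.inr hex
    · left
      simp only [Set.mem_ofPred_eq] at hω ⊢
      have h1 : ∀ i, f (ξ i ω) = l * tailSq M (ξ i ω) := by
        intro i
        have h2 : ‖ξ i ω‖ ^ 2 < z / A := by
          by_contra hcon
          refine hex ⟨i, ?_⟩
          rw [hS, Set.mem_ofPred_eq, ← hnorm]
          exact Real.rpow_le_rpow (by positivity) (not_lt.1 hcon) (by positivity)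
        simp [hf, h2]
      simp only [h1, ← Finset.mul_sum]
      nlinarith [mul_le_mul_of_nonneg_left hω hl0.le]
  have hzq : 0 ≤ z ^ (-(q / 2)) := by positivity
  calc _ ≤ Real.exp B * z ^ (-(q / 2)) + N * (K * A ^ (q / 2) * z ^ (-(q / 2))) :=
        (measureReal_mono hsub (measure_ne_top _ _)).trans ((measureReal_union_le _ _).trans
          (add_le_add (hch.trans hexpo) ((h.real_exists_mem_le hSm).trans (by gcongr))))
    _ ≤ N * (Real.exp B * z ^ (-(q / 2))) + N * (K * A ^ (q / 2) * z ^ (-(q / 2))) := by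
        refine add_le_add_left ?_ _
        exact le_mul_of_one_le_left (by positivity) hN1
    _ = (Real.exp B + K * A ^ (q / 2)) * (N * z ^ (-(q / 2))) := by ring
    _ ≤ _ := by
        gcongr
        linarith [Real.exp_pos (q / 2)]

end TailDeviation

/-! ### Concentration under the moment conditions -/

theorem exists_one_add_rpow_le {p α δ : ℝ} (hp : 0 ≤ p) (hα : 0 < α) (hδ : 0 < δ) :
    ∃ B : ℝ, 0 < B ∧ ∀ t : ℝ, 0 ≤ t → 1 + t ^ p ≤ B * Real.exp (δ * t ^ α) := by
  set m : ℕ := ⌈p / α⌉₊ with hm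
  refine ⟨2 + m.factorial / δ ^ m, by positivity, fun t ht => ?_⟩
  have hexp : 1 ≤ Real.exp (δ * t ^ α) := Real.one_le_exp (by positivity)
  have h1 : t ^ p ≤ 1 + (t ^ α) ^ m := by
    rcases le_or_gt t 1 with h | h
    · have := Real.rpow_le_one ht h hp
      have h0 : 0 ≤ (t ^ α) ^ m := by positivity
      linarith
    · have h2 : p ≤ α * m := by
        have := Nat.le_ceil (p / α)
        rw [div_le_iff₀ hα] at this
        linarith
      calc t ^ p ≤ t ^ (α * m) := Real.rpow_le_rpow_of_exponent_le h.le h2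
        _ = (t ^ α) ^ m := by rw [Real.rpow_mul ht, Real.rpow_natCast]
        _ ≤ _ := by linarith
  have h3 : (t ^ α) ^ m ≤ m.factorial / δ ^ m * Real.exp (δ * t ^ α) := by
    have := Real.pow_div_factorial_le_exp (δ * t ^ α) (by positivity) m
    rw [div_le_iff₀ (by positivity), mul_pow] at this
    rw [div_mul_eq_mul_div, le_div_iff₀ (by positivity)]
    linarith
  rw [add_mul]
  linarith

theorem exists_pow_between {r b x : ℝ} (hr : 1 < r) (hx : 0 < x) (hxb : x ≤ b) :
    ∃ k : ℕ, b ≤ x * r ^ k ∧ x * r ^ k ≤ r * b := by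
  obtain ⟨n, hn1, hn2⟩ := exists_nat_pow_near ((one_le_div hx).2 hxb) hr
  rw [le_div_iff₀ hx] at hn1
  rw [div_lt_iff₀ hx] at hn2
  refine ⟨n + 1, by linarith, ?_⟩
  rw [pow_succ]
  nlinarith

section

variable {d : ℕ} {μ : Measure (Space d)}

theorem lintegral_mono_ofReal_mul {f g : Space d → ℝ} {b c : ℝ} (hc : 0 ≤ c)
    (hfg : ∀ y, f y ≤ c * g y) (hg : ∫⁻ y, ENNReal.ofReal (g y) ∂μ ≤ ENNReal.ofReal b) :
    ∫⁻ y, ENNReal.ofReal (f y) ∂μ ≤ ENNReal.ofReal (c * b) :=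
  (lintegral_mono fun y => ENNReal.ofReal_le_ofReal (hfg y)).trans
    (lintegral_ofReal_const_mul_le hc hg)

variable [IsProbabilityMeasure μ]

theorem lintegral_one_add_rpow_le {q K : ℝ} (hK : 0 ≤ K)
    (h : powerMoment q μ ≤ ENNReal.ofReal K) :
    ∫⁻ y, ENNReal.ofReal (1 + ‖y‖ ^ q) ∂μ ≤ ENNReal.ofReal (1 + K) := by
  have e : ∀ y : Space d, ENNReal.ofReal (1 + ‖y‖ ^ q) = 1 + ENNReal.ofReal (‖y‖ ^ q) := fun y => by
    rw [ENNReal.ofReal_add zero_le_one (by positivity), ENNReal.ofReal_one]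
  simp only [e]
  rw [lintegral_add_left measurable_const, ENNReal.ofReal_add zero_le_one hK, ENNReal.ofReal_one,
    lintegral_const, measure_univ, mul_one]
  exact add_le_add le_rfl h

/-- Markov's inequality. The shell of index `k + 1` begins at radius `2 ^ k`, whence the factor `2 ^
q`; the innermost shell is a full ball and only has the trivial bound. -/
theorem real_shell_le {q K K' : ℝ} (hq : 0 ≤ q) (hK : 0 ≤ K) (hK'1 : 1 ≤ K') (hK' : K * 2 ^ q ≤ K')
    (h : powerMoment q μ ≤ ENNReal.ofReal K) (k : ℕ) :
    μ.real (shell ⁻¹' {k}) ≤ K' / ((2 : ℝ) ^ q) ^ k := by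
  cases k with
  | zero => simpa using measureReal_le_one.trans hK'1
  | succ k =>
    have h1 : μ.real {y | ((2 : ℝ) ^ q) ^ k ≤ ‖y‖ ^ q} ≤ K / ((2 : ℝ) ^ q) ^ k :=
      real_ge_le_of_lintegral_le (by fun_prop) hK (by positivity) h
    have h2 : shell ⁻¹' {k + 1} ⊆ {y : Space d | ((2 : ℝ) ^ q) ^ k ≤ ‖y‖ ^ q} := by
      intro y hy
      have h3 : shell y = k + 1 := hy
      have h4 : (2 : ℝ) ^ k ≤ ‖y‖ := not_lt.1 fun hlt => by
        have := shell_le_iff.2 hlt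
        omega
      rw [Set.mem_ofPred_eq, ← Real.rpow_natCast, ← Real.rpow_mul zero_le_two, mul_comm,
        Real.rpow_mul zero_le_two, Real.rpow_natCast]
      exact Real.rpow_le_rpow (by positivity) h4 hq
    calc _ ≤ K / ((2 : ℝ) ^ q) ^ k := (measureReal_mono h2 (measure_ne_top _ _)).trans h1
      _ = K * 2 ^ q / ((2 : ℝ) ^ q) ^ (k + 1) := by
        rw [pow_succ]
        field_simp
      _ ≤ _ := by gcongr

theorem tailSq_succ_le {q : ℝ} (hq : 2 ≤ q) (k : ℕ) (y : Space d) :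
    tailSq (k + 1) y * ((2 : ℝ) ^ (q - 2)) ^ k ≤ ‖y‖ ^ q := by
  unfold tailSq
  split_ifs with h
  · have h1 : (2 : ℝ) ^ k ≤ ‖y‖ := not_lt.1 fun hlt => by
      have := shell_le_iff.2 hlt
      omega
    have h2 : 0 < ‖y‖ := lt_of_lt_of_le (by positivity) h1
    have h3 : ((2 : ℝ) ^ (q - 2)) ^ k ≤ ‖y‖ ^ (q - 2) := by
      rw [← Real.rpow_natCast, ← Real.rpow_mul zero_le_two, mul_comm,
        Real.rpow_mul zero_le_two, Real.rpow_natCast]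
      exact Real.rpow_le_rpow (by positivity) h1 (by linarith)
    calc _ ≤ ‖y‖ ^ 2 * ‖y‖ ^ (q - 2) := by gcongr
      _ = ‖y‖ ^ q := by
        rw [← Real.rpow_natCast, ← Real.rpow_add h2]
        congr 1
        push_cast
        ring
  · rw [zero_mul]
    positivity

end

/-- Concentration up to the deviation of a tail, which is small in the mean. -/
theorem exists_quadCost_le_tail (d : ℕ) (hd : 1 ≤ d) {q K b : ℝ} (hq : 4 < q) (hK : 0 ≤ K)
    (hb : 8 * (1 + K) ≤ b) :
    ∃ c C : ℝ, 0 < c ∧ 0 < C ∧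
      ∀ (Ω : Type*) [MeasurableSpace Ω] (P : Measure Ω) [IsProbabilityMeasure P] (N : ℕ)
        (ξ : Fin N → Ω → Space d) (μ : Measure (Space d)) [IsProbabilityMeasure μ],
        1 ≤ N → IsSample P ξ μ → powerMoment q μ ≤ ENNReal.ofReal K → ∀ x : ℝ, 0 < x →
        ∃ M : ℕ, (∀ y : Space d, tailSq M y ≤ x / b * (1 + ‖y‖ ^ q)) ∧
          P.real {ω | ENNReal.ofReal x ≤ quadCost (empiricalMeasure fun i => ξ i ω) μ} ≤
            (if x ≤ b then C * Real.exp (-(c * N * rate d x ^ 2)) else 0) +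
              P.real {ω | N * (x / 4) ≤ ∑ i, tailSq M (ξ i ω)} := by
  have hb0 : 0 < b := by linarith
  -- Now `16 β³ = 2^q` is the decay of the shell masses and `4 β³ = 2^(q-2)` that of the second
  -- moments outside the shells.
  set β : ℝ := 2 ^ ((q - 4) / 3) with hβ
  have hβ1 : 1 < β := Real.one_lt_rpow one_lt_two (by linarith)
  have hβ3 : β ^ 3 = 2 ^ (q - 4) := by
    rw [hβ, ← Real.rpow_natCast, ← Real.rpow_mul zero_le_two]
    congr 1
    push_cast
    ring
  have e4 : 4 * β ^ 3 = 2 ^ (q - 2) := by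
    rw [hβ3, show (4 : ℝ) = 2 ^ (2 : ℝ) by norm_num, ← Real.rpow_add two_pos]
    congr 1
    ring
  have e16 : 16 * β ^ 3 = 2 ^ q := by
    rw [hβ3, show (16 : ℝ) = 2 ^ (4 : ℝ) by norm_num, ← Real.rpow_add two_pos]
    congr 1
    ring
  have hr1 : 1 < (2 : ℝ) ^ (q - 2) := Real.one_lt_rpow one_lt_two (by linarith)
  set K' : ℝ := 1 + K * 2 ^ q + 2 ^ (q - 2) * b with hK'
  have hK2 : 0 ≤ K * 2 ^ q := by positivity
  have hK3 : 0 ≤ 2 ^ (q - 2) * b := by positivity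
  obtain ⟨c, C, hc, hC, hmain⟩ :=
    exists_quadCost_concentration d hd hβ1 (K := K') (by linarith)
  refine ⟨c, C, hc, hC, ?_⟩
  intro Ω _ P _ N ξ μ _ hN h hmom x hx
  have htail : ∀ M, (∀ y : Space d, tailSq M y ≤ x / b * (1 + ‖y‖ ^ q)) →
      ∫⁻ y, ENNReal.ofReal (tailSq M y) ∂μ ≤ ENNReal.ofReal (x / 8) := by
    intro M hM
    refine (lintegral_mono_ofReal_mul (by positivity) hM
      (lintegral_one_add_rpow_le hK hmom)).trans (ENNReal.ofReal_le_ofReal ?_)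
    rw [div_mul_eq_mul_div, div_le_div_iff₀ hb0 (by norm_num)]
    nlinarith
  by_cases hxb : x ≤ b
  -- Enough shells to make the tail small, yet few enough for the accuracies `y k` to stay below
  -- `1`: `x 2^((q-2)k)` lies between `b` and `2^(q-2) b`.
  · obtain ⟨k, hk1, hk2⟩ := exists_pow_between hr1 hx hxb
    have hM : ∀ y : Space d, tailSq (k + 1) y ≤ x / b * (1 + ‖y‖ ^ q) := by
      intro y
      have h1 := tailSq_succ_le (by linarith : 2 ≤ q) k y
      have h2 := tailSq_nonneg (k + 1) y
      rw [div_mul_eq_mul_div, le_div_iff₀ hb0]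
      calc tailSq (k + 1) y * b ≤ tailSq (k + 1) y * (x * ((2 : ℝ) ^ (q - 2)) ^ k) := by gcongr
        _ = x * (tailSq (k + 1) y * ((2 : ℝ) ^ (q - 2)) ^ k) := by ring
        _ ≤ x * (1 + ‖y‖ ^ q) := by
          gcongr
          linarith
    refine ⟨k + 1, hM, ?_⟩
    rw [if_pos hxb]
    refine hmain Ω P N ξ μ hN h x (k + 1) hx (fun j hj => ?_) (fun j => ?_) (htail _ hM)
    · rw [e4]
      have h1 : x * ((2 : ℝ) ^ (q - 2)) ^ j ≤ x * ((2 : ℝ) ^ (q - 2)) ^ k := by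
        gcongr
        · exact hr1.le
        · omega
      linarith
    · rw [e16]
      exact real_shell_le (by linarith) hK (by linarith) (by linarith) hmom j
  -- For `x > b` no shell is needed: everything counts as tail, and the shell term is absent.
  · have hM : ∀ y : Space d, tailSq 0 y ≤ x / b * (1 + ‖y‖ ^ q) := by
      intro y
      refine (tailSq_le 0 y).trans ?_
      have h1 : ‖y‖ ^ 2 ≤ 1 + ‖y‖ ^ q := by
        rcases le_or_gt ‖y‖ 1 with h1 | h1
        · have h2 : 0 ≤ ‖y‖ ^ q := by positivity
          nlinarith [norm_nonneg y]
        · rw [← Real.rpow_natCast]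
          have := Real.rpow_le_rpow_of_exponent_le h1.le (by push_cast; linarith : ((2 : ℕ) : ℝ) ≤ q)
          linarith
      refine h1.trans (le_mul_of_one_le_left (by positivity) ?_)
      exact (one_le_div hb0).2 (not_le.1 hxb).le
    refine ⟨0, hM, ?_⟩
    rw [if_neg hxb, zero_add]
    refine measureReal_mono (fun ω hω => ?_) (measure_ne_top _ _)
    rcases exists_shellBound_lt_or (M := 0) (m := fun _ => 0) (t := fun _ => 0) hN hx (htail 0 hM)
      (by simpa using by positivity) hω with ⟨k, hk, -⟩ | hT
    · exact absurd hk (Nat.not_lt_zero k)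
    · exact hT

/-! ### The bounds of the theorem -/

/-- Normalisation: `L` enters only through `x = 2 ε / L`, so all estimates can be made for `L = 2`.
-/
theorem boundB_eq (c C : ℝ) {L : ℝ} (hL : 0 < L) (n : ℕ) (ε : ℝ) (T : MomentCondition) :
    boundB c C L n ε T = boundB c C 2 n (2 * ε / L) T := by
  have e1 : 2 * (2 * ε / L) / 2 = 2 * ε / L := by ring
  have e2 : 2 * n * (2 * ε / L) / 2 = 2 * n * ε / L := by ring
  have e3 : (2 : ℝ) / 2 < 2 * ε / L ↔ L / 2 < ε := by
    rw [div_self two_ne_zero, lt_div_iff₀ hL, div_lt_iff₀ two_pos]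
    constructor <;> intro h <;> linarith
  have e4 : 2 * ε / L ≤ 2 / 2 ↔ ε ≤ L / 2 := by
    rw [← not_lt, e3, not_lt]
  cases T <;> simp only [boundB, e1, e2, e3, e4]

theorem boundB_two_expHigh (c C : ℝ) (n : ℕ) (x α γ : ℝ) :
    boundB c C 2 n x (.expHigh α γ) =
      C * if 1 < x then Real.exp (-(c * n * x ^ (α / 2))) else 0 := by
  simp [boundB]

theorem boundB_two_expLow (c C : ℝ) (n : ℕ) (x α γ η : ℝ) :
    boundB c C 2 n x (.expLow α γ η) =
      C * ((if x ≤ 1 then Real.exp (-(c * (n * x) ^ ((α - η) / 2))) else 0) +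
        (if 1 < x then Real.exp (-(c * (n * x) ^ (α / 2))) else 0)) := by
  have e : 2 * n * x / 2 = n * x := by ring
  simp [boundB, e]

theorem boundB_two_power (c C : ℝ) (n : ℕ) (x q η : ℝ) :
    boundB c C 2 n x (.power q η) = C * (n * (n * x) ^ (-((q - η) / 2))) := by
  have e : 2 * n * x / 2 = n * x := by ring
  simp [boundB, e]

theorem boundB_nonneg (c : ℝ) {C x : ℝ} (hC : 0 ≤ C) (hx : 0 ≤ x) (n : ℕ) (T : MomentCondition) :
    0 ≤ boundB c C 2 n x T := by
  cases T with
  | expHigh α γ => rw [boundB_two_expHigh]; split_ifs <;> positivity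
  | expLow α γ η => rw [boundB_two_expLow]; split_ifs <;> positivity
  | power q η => rw [boundB_two_power]; positivity

theorem boundB_anti {c c' C x : ℝ} (hcc : c' ≤ c) (hC : 0 ≤ C) (hx : 0 ≤ x) (n : ℕ)
    (T : MomentCondition) : boundB c C 2 n x T ≤ boundB c' C 2 n x T := by
  cases T with
  | expHigh α γ => rw [boundB_two_expHigh, boundB_two_expHigh]; split_ifs <;> gcongr
  | expLow α γ η => rw [boundB_two_expLow, boundB_two_expLow]; split_ifs <;> gcongr
  | power q η => rw [boundB_two_power, boundB_two_power]

universe u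

/-- The concentration inequality for the quadratic transport cost under the condition `T`. -/
def Concentrates (d : ℕ) (T : MomentCondition) (K : ℝ≥0) : Prop :=
  ∃ c C : ℝ, 0 < c ∧ 0 < C ∧
    ∀ (Ω : Type u) [MeasurableSpace Ω] (P : Measure Ω) [IsProbabilityMeasure P] (N : ℕ)
      (ξ : Fin N → Ω → Space d) (μ : Measure (Space d)) [IsProbabilityMeasure μ],
      1 ≤ N → IsSample P ξ μ → T.moment μ ≤ K → ∀ x : ℝ, 0 < x →
      P.real {ω | ENNReal.ofReal x ≤ quadCost (empiricalMeasure fun i => ξ i ω) μ} ≤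
        (if x ≤ 1 then C * Real.exp (-(c * N * rate d x ^ 2)) else 0) + boundB c C 2 N x T

/-- In this range the bound is trivial. Outside it `N ≤ (N x)²`, which absorbs stray factors `N`. -/
theorem measureReal_le_of_mul_sq_lt_one {Ω : Type*} [MeasurableSpace Ω] {P : Measure Ω}
    [IsProbabilityMeasure P] (s : Set Ω) (d : ℕ) {N : ℕ} (hN : 1 ≤ N) {x c C : ℝ} (hx : 0 < x)
    (hNx : N * x ^ 2 < 1) (hc : c ≤ 1) (hC : Real.exp 1 ≤ C) :
    P.real s ≤ if x ≤ 1 then C * Real.exp (-(c * N * rate d x ^ 2)) else 0 := by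
  have hN1 : (1 : ℝ) ≤ N := by exact_mod_cast hN
  have hx1 : x ≤ 1 := by
    by_contra hcon
    nlinarith
  rw [if_pos hx1]
  refine measureReal_le_mul_exp ?_ hC
  have h1 := rate_le d hx hx1
  have h2 := rate_pos d hx
  calc c * N * rate d x ^ 2 ≤ 1 * N * x ^ 2 := by gcongr
    _ < 1 := by linarith

theorem mul_exp_add_mul_exp_le {a b u v w : ℝ} (ha : 0 ≤ a) (hb : 0 ≤ b) (hu : w ≤ u)
    (hv : w ≤ v) : a * Real.exp (-u) + b * Real.exp (-v) ≤ (a + b) * Real.exp (-w) := by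
  rw [add_mul]
  gcongr

theorem rate_one_le (d : ℕ) {x : ℝ} (hx : 1 ≤ x) : rate d 1 ≤ rate d x := by
  have h1 := mul_rate_le d hx one_pos
  rw [mul_one] at h1
  exact (le_mul_of_one_le_left (rate_pos d one_pos).le hx).trans h1

theorem powerMoment_le_of_expMoment_le {d : ℕ} {μ : Measure (Space d)} {α γ q W : ℝ} {K : ℝ≥0}
    (hW : 0 ≤ W) (h : ∀ t : ℝ, 0 ≤ t → t ^ q ≤ W * Real.exp (γ * t ^ α))
    (hmom : expMoment α γ μ ≤ K) : powerMoment q μ ≤ ENNReal.ofReal (W * K) :=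
  lintegral_mono_ofReal_mul hW (fun y => h ‖y‖ (norm_nonneg y))
    (hmom.trans_eq (ENNReal.ofReal_coe_nnreal).symm)

/-- The pointwise bound on `tailSq M` survives multiplication by any weight `w` that the exponential
moment dominates. The weights used are those required by the Chernoff bounds of the tail. -/
theorem lintegral_tailSq_mul_le {d : ℕ} {μ : Measure (Space d)} {α γ q W b x : ℝ} {K : ℝ≥0}
    {w : ℝ → ℝ} (hw : ∀ t, 0 ≤ w t) (hW : 0 ≤ W)
    (h : ∀ t : ℝ, 0 ≤ t → (1 + t ^ q) * w t ≤ W * Real.exp (γ * t ^ α))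
    (hmom : expMoment α γ μ ≤ K) (hb0 : 0 < b) (hb : 8 * (1 + W * K) ≤ b) (hx : 0 < x) {M : ℕ}
    (hM : ∀ y : Space d, tailSq M y ≤ x / b * (1 + ‖y‖ ^ q)) :
    ∫⁻ y, ENNReal.ofReal (tailSq M y * w ‖y‖) ∂μ ≤ ENNReal.ofReal (x / 8) := by
  refine (lintegral_mono_ofReal_mul (f := fun y => tailSq M y * w ‖y‖)
    (g := fun y => Real.exp (γ * ‖y‖ ^ α)) (c := x / b * W) (by positivity)
    (fun y => ?_) (hmom.trans_eq (ENNReal.ofReal_coe_nnreal).symm)).trans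
    (ENNReal.ofReal_le_ofReal ?_)
  · calc _ ≤ x / b * (1 + ‖y‖ ^ q) * w ‖y‖ := mul_le_mul_of_nonneg_right (hM y) (hw _)
      _ = x / b * ((1 + ‖y‖ ^ q) * w ‖y‖) := by ring
      _ ≤ x / b * (W * Real.exp (γ * ‖y‖ ^ α)) :=
        mul_le_mul_of_nonneg_left (h ‖y‖ (norm_nonneg y)) (by positivity)
      _ = _ := by ring
  · rw [mul_assoc, div_mul_eq_mul_div, div_le_div_iff₀ hb0 (by norm_num)]
    have : 0 ≤ W * K := by positivity
    nlinarith

theorem exists_sq_le_rpow {α γ : ℝ} (hα : 2 < α) (hγ : 0 < γ) :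
    ∃ T : ℝ, 0 ≤ T ∧ ∀ t : ℝ, 0 ≤ t → t ^ 2 ≤ γ * t ^ α + T := by
  set S : ℝ := (1 / γ) ^ (1 / (α - 2)) with hS
  have hS0 : 0 < S := by positivity
  have hSα : S ^ (α - 2) = 1 / γ := by
    rw [hS, ← Real.rpow_mul (by positivity), one_div_mul_cancel (by linarith), Real.rpow_one]
  refine ⟨S ^ 2, by positivity, fun t ht => ?_⟩
  rcases le_or_gt t S with h | h
  · have h1 : t ^ 2 ≤ S ^ 2 := by gcongr
    have h2 : 0 ≤ γ * t ^ α := by positivity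
    linarith
  · have ht0 : 0 < t := hS0.trans h
    have h1 : 1 / γ ≤ t ^ (α - 2) := by
      rw [← hSα]
      exact Real.rpow_le_rpow hS0.le h.le (by linarith)
    have h2 : t ^ α = t ^ (α - 2) * t ^ 2 := by
      rw [← Real.rpow_natCast, ← Real.rpow_add ht0]
      congr 1
      push_cast
      ring
    rw [div_le_iff₀ hγ] at h1
    rw [h2]
    nlinarith [sq_nonneg t, sq_nonneg S]

theorem concentrates_expHigh (d : ℕ) (hd : 1 ≤ d) {α γ : ℝ} (hα : 2 < α) (hγ : 0 < γ) (K : ℝ≥0) :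
    Concentrates.{u} d (.expHigh α γ) K := by
  obtain ⟨B, hB0, hB⟩ := exists_one_add_rpow_le (p := 5) (α := α) (δ := γ / 2) (by norm_num)
    (by linarith) (by positivity)
  obtain ⟨T, hT0, hT⟩ := exists_sq_le_rpow hα (half_pos hγ)
  set W : ℝ := B * Real.exp T with hW
  have hW0 : 0 < W := by positivity
  have hweight : ∀ t : ℝ, 0 ≤ t →
      (1 + t ^ (5 : ℝ)) * Real.exp (t ^ 2) ≤ W * Real.exp (γ * t ^ α) := by
    intro t ht
    have h1 := hB t ht
    have h2 : Real.exp (t ^ 2) ≤ Real.exp (γ / 2 * t ^ α + T) := Real.exp_le_exp.2 (hT t ht)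
    calc _ ≤ B * Real.exp (γ / 2 * t ^ α) * Real.exp (γ / 2 * t ^ α + T) := by gcongr
      _ = B * Real.exp T * Real.exp (γ / 2 * t ^ α + γ / 2 * t ^ α) := by
        rw [Real.exp_add, Real.exp_add]
        ring
      _ = _ := by
        rw [← add_mul, add_halves]
  have hpow : ∀ t : ℝ, 0 ≤ t → t ^ (5 : ℝ) ≤ W * Real.exp (γ * t ^ α) := by
    intro t ht
    refine le_trans ?_ (hweight t ht)
    have h1 : 1 ≤ Real.exp (t ^ 2) := Real.one_le_exp (by positivity)
    have h2 : 0 ≤ t ^ (5 : ℝ) := by positivity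
    nlinarith
  set a : ℝ := Real.log (1 + K) with ha
  have ha0 : 0 ≤ a := Real.log_nonneg (by have := K.2; simp)
  -- The first summand makes the weighted mean of the tail small. The second ensures `2 a ≤ γ (x /
  -- 4)^(α / 2)` for `x > b`, as `IsSample.tail_expHigh` requires. The intermediate power `q = 5`
  -- could be any number above `4`.
  set b : ℝ := 8 * (1 + W * K) + 4 * (2 * a / γ) ^ (2 / α) with hb
  have hWK : 0 ≤ W * K := by positivity
  have hbb : 0 ≤ 4 * (2 * a / γ) ^ (2 / α) := by positivity
  have hb1 : 8 * (1 + W * K) ≤ b := by linarith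
  have hb8 : 8 ≤ b := by linarith
  obtain ⟨c₀, C₀, hc₀, hC₀, hmain⟩ := exists_quadCost_le_tail d hd (q := 5) (K := W * K) (b := b)
    (by norm_num) hWK hb1
  have hr1 := rate_pos d one_pos
  set c₂ : ℝ := c₀ * rate d 1 ^ 2 with hc₂
  have hbα : 0 < b ^ (α / 2) := by positivity
  set c : ℝ := min (min c₀ (1 / 8)) (min (min (c₂ / b ^ (α / 2)) (1 / 8 / b ^ (α / 2)))
    (γ / 2 / 4 ^ (α / 2))) with hc
  have hcpos : 0 < c := by positivity
  have l1 : c ≤ c₀ := (min_le_left _ _).trans (min_le_left _ _)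
  have l2 : c ≤ 1 / 8 := (min_le_left _ _).trans (min_le_right _ _)
  have l3 : c * b ^ (α / 2) ≤ c₂ := (le_div_iff₀ hbα).1
    ((min_le_right _ _).trans ((min_le_left _ _).trans (min_le_left _ _)))
  have l4 : c * b ^ (α / 2) ≤ 1 / 8 := (le_div_iff₀ hbα).1
    ((min_le_right _ _).trans ((min_le_left _ _).trans (min_le_right _ _)))
  have l5 : c * 4 ^ (α / 2) ≤ γ / 2 := (le_div_iff₀ (by positivity)).1
    ((min_le_right _ _).trans (min_le_right _ _))
  refine ⟨c, C₀ + 1, hcpos, by positivity, ?_⟩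
  intro Ω _ P _ N ξ μ _ hN h hmom x hx
  have hmom' : expMoment α γ μ ≤ K := hmom
  obtain ⟨M, hM, hP⟩ := hmain Ω P N ξ μ hN h
    (powerMoment_le_of_expMoment_le hW0.le hpow hmom') x hx
  refine hP.trans ?_
  rw [boundB_two_expHigh]
  have hN0 : (0 : ℝ) < N := by positivity
  rcases le_or_gt x b with hxb | hxb
  · have htail := h.tail_subgaussian hx (M := M) (lintegral_tailSq_mul_le
      (w := fun t => Real.exp (t ^ 2)) (fun t => (Real.exp_pos _).le) hW0.le hweight hmom'
      (by linarith) hb1 hx hM)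
    rw [if_pos hxb]
    rw [← one_mul (Real.exp (-(N * x / 8)))] at htail
    refine (add_le_add le_rfl htail).trans ?_
    rcases le_or_gt x 1 with hx1 | hx1
    · rw [if_pos hx1, if_neg hx1.not_gt, mul_zero, add_zero]
      have h1 := rate_le d hx hx1
      have h2 := rate_pos d hx
      refine mul_exp_add_mul_exp_le hC₀.le zero_le_one (by gcongr) ?_
      have h3 : rate d x ^ 2 ≤ x := by nlinarith
      calc c * N * rate d x ^ 2 ≤ 1 / 8 * N * x := by gcongr
        _ = _ := by ring
    · rw [if_neg hx1.not_ge, if_pos hx1, zero_add]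
      -- For `1 < x ≤ b` all exponents are comparable to `N`, so a small `c` suffices.
      have h1 : c * x ^ (α / 2) ≤ c * b ^ (α / 2) := by gcongr
      refine mul_exp_add_mul_exp_le hC₀.le zero_le_one ?_ ?_
      · have h2 : c₂ ≤ c₀ * rate d x ^ 2 := by
          rw [hc₂]
          gcongr
          exact rate_one_le d hx1.le
        calc c * N * x ^ (α / 2) = N * (c * x ^ (α / 2)) := by ring
          _ ≤ N * (c₀ * rate d x ^ 2) := mul_le_mul_of_nonneg_left (by linarith) hN0.le
          _ = _ := by ring
      · calc c * N * x ^ (α / 2) = N * (c * x ^ (α / 2)) := by ring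
          _ ≤ N * (x / 8) := mul_le_mul_of_nonneg_left (by linarith) hN0.le
          _ = _ := by ring
  · have hx1 : 1 < x := by linarith
    rw [if_neg hxb.not_ge, if_neg hx1.not_ge, if_pos hx1, zero_add, zero_add]
    have hmom2 : expMoment α γ μ ≤ ENNReal.ofReal (Real.exp a) := by
      rw [ha, Real.exp_log (by positivity)]
      refine hmom'.trans ?_
      rw [← ENNReal.ofReal_coe_nnreal]
      exact ENNReal.ofReal_le_ofReal (by linarith)
    have hax : 2 * a ≤ γ * (x / 4) ^ (α / 2) := by
      have h1 : (2 * a / γ) ^ (2 / α) ≤ x / 4 := by linarith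
      have h2 := Real.rpow_le_rpow (by positivity) h1 (by linarith : 0 ≤ α / 2)
      rw [← Real.rpow_mul (by positivity), show 2 / α * (α / 2) = 1 by field_simp, Real.rpow_one,
        div_le_iff₀ hγ] at h2
      linarith
    refine (h.tail_expHigh hN hα hγ hmom2 hx hax M).trans ?_
    refine (Real.exp_le_exp.2 ?_).trans (le_mul_of_one_le_left (Real.exp_pos _).le (by linarith))
    have h3 : x ^ (α / 2) = 4 ^ (α / 2) * (x / 4) ^ (α / 2) := by
      rw [← Real.mul_rpow (by norm_num) (by positivity)]
      congr 1
      ring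
    rw [neg_le_neg_iff, h3]
    calc c * N * (4 ^ (α / 2) * (x / 4) ^ (α / 2)) =
        c * 4 ^ (α / 2) * (N * (x / 4) ^ (α / 2)) := by ring
      _ ≤ γ / 2 * (N * (x / 4) ^ (α / 2)) := by gcongr
      _ = _ := by ring

theorem concentrates_expLow (d : ℕ) (hd : 1 ≤ d) {α γ η : ℝ} (hα0 : 0 < α) (hα : α < 2)
    (hγ : 0 < γ) (hη : 0 < η) (K : ℝ≥0) :
    Concentrates.{u} d (.expLow α γ η) K := by
  obtain ⟨W, hW0, hB⟩ := exists_one_add_rpow_le (p := 5) (α := α) (δ := γ / 2) (by norm_num)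
    hα0 (by positivity)
  obtain ⟨B₂, hB₂0, hB₂⟩ := exists_one_add_rpow_le (p := 2) (α := α / 2) (δ := γ / 2) (by norm_num)
    (by positivity) (by positivity)
  have hweight : ∀ t : ℝ, 0 ≤ t →
      (1 + t ^ (5 : ℝ)) * Real.exp (γ / 2 * t ^ α) ≤ W * Real.exp (γ * t ^ α) := by
    intro t ht
    calc _ ≤ W * Real.exp (γ / 2 * t ^ α) * Real.exp (γ / 2 * t ^ α) := by
          gcongr
          exact hB t ht
      _ = _ := by rw [mul_assoc, ← Real.exp_add, ← add_mul, add_halves]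
  have hpow : ∀ t : ℝ, 0 ≤ t → t ^ (5 : ℝ) ≤ W * Real.exp (γ * t ^ α) := by
    intro t ht
    refine le_trans ?_ (hweight t ht)
    have h1 : 1 ≤ Real.exp (γ / 2 * t ^ α) := Real.one_le_exp (by positivity)
    have h2 : 0 ≤ t ^ (5 : ℝ) := by positivity
    nlinarith
  set b : ℝ := 8 * (1 + W * K) with hb
  have hWK : 0 ≤ W * K := by positivity
  have hb8 : 8 ≤ b := by linarith
  obtain ⟨c₀, C₀, hc₀, hC₀, hmain⟩ := exists_quadCost_le_tail d hd (q := 5) (K := W * K) (b := b)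
    (by norm_num) hWK le_rfl
  have hr1 := rate_pos d one_pos
  set c₂ : ℝ := c₀ * rate d 1 ^ 2 with hc₂
  set c : ℝ := min (min c₀ 1) (min (γ / 16) (c₂ / b)) with hc
  have hb0 : 0 < b := by linarith
  have hcpos : 0 < c := by positivity
  have l1 : c ≤ c₀ := (min_le_left _ _).trans (min_le_left _ _)
  have l2 : c ≤ 1 := (min_le_left _ _).trans (min_le_right _ _)
  have l3 : c ≤ γ / 16 := (min_le_right _ _).trans (min_le_left _ _)
  have l4 : c * b ≤ c₂ := (le_div_iff₀ hb0).1 ((min_le_right _ _).trans (min_le_right _ _))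
  set D : ℝ := 1 + K * B₂ with hD
  have hD0 : 0 < D := by positivity
  have he := Real.exp_pos 1
  set C : ℝ := Real.exp 1 + (C₀ + D) with hC
  have hCpos : 0 < C := by positivity
  refine ⟨c, C, hcpos, hCpos, ?_⟩
  intro Ω _ P _ N ξ μ _ hN h hmom x hx
  have hmom' : expMoment α γ μ ≤ K := hmom
  rcases lt_or_ge (N * x ^ 2) 1 with hNx | hNx
  · exact (measureReal_le_of_mul_sq_lt_one _ d hN hx hNx l2 (by linarith)).trans
      (le_add_of_nonneg_right (boundB_nonneg c hCpos.le hx.le N _))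
  obtain ⟨M, hM, hP⟩ := hmain Ω P N ξ μ hN h
    (powerMoment_le_of_expMoment_le hW0.le hpow hmom') x hx
  have hN0 : (0 : ℝ) < N := by positivity
  have hN1 : (1 : ℝ) ≤ N := by exact_mod_cast hN
  have htail := h.tail_expLow hN hα0 hα hγ K.2 (hmom'.trans_eq ENNReal.ofReal_coe_nnreal.symm) hx
    (M := M) (lintegral_tailSq_mul_le (w := fun t => Real.exp (γ / 2 * t ^ α))
      (fun t => (Real.exp_pos _).le) hW0.le hweight hmom' hb0 le_rfl hx hM)
  set z : ℝ := N * x with hz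
  have hz0 : 0 < z := by positivity
  set w : ℝ := z ^ (α / 2) with hw
  have hw0 : 0 < w := by positivity
  have htail' : P.real {ω | N * (x / 4) ≤ ∑ i, tailSq M (ξ i ω)} ≤ D * Real.exp (-(c * w)) := by
    -- The factor `N` of the union bound costs half of the exponent.
    have hNz : (N : ℝ) ≤ B₂ * Real.exp (γ / 2 * w) := by
      have h1 := hB₂ z hz0.le
      have h2 : (N : ℝ) ≤ z ^ (2 : ℝ) := by
        rw [hz, Real.rpow_two, mul_pow]
        nlinarith
      linarith
    have h3 : N * (K * Real.exp (-(γ * w))) ≤ K * B₂ * Real.exp (-(γ / 2 * w)) := by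
      calc _ ≤ B₂ * Real.exp (γ / 2 * w) * (K * Real.exp (-(γ * w))) := by gcongr
        _ = K * B₂ * Real.exp (γ / 2 * w + -(γ * w)) := by
          rw [Real.exp_add]
          ring
        _ = _ := by
          congr 2
          ring
    refine htail.trans ((add_le_add le_rfl h3).trans ?_)
    rw [← one_mul (Real.exp (-(γ / 16 * w)))]
    exact mul_exp_add_mul_exp_le zero_le_one (by positivity) (by gcongr)
      (by gcongr; linarith)
  refine (hP.trans (add_le_add le_rfl htail')).trans ?_
  rw [boundB_two_expLow, ← hz, ← hw]
  rcases le_or_gt x 1 with hx1 | hx1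
  · rw [if_pos (by linarith : x ≤ b), if_pos hx1, if_pos hx1, if_neg hx1.not_gt, add_zero]
    have hz1 : 1 ≤ z := by nlinarith
    have h1 : z ^ ((α - η) / 2) ≤ w := Real.rpow_le_rpow_of_exponent_le hz1 (by linarith)
    gcongr
    · linarith
    · linarith
  · rw [if_neg hx1.not_ge, if_neg hx1.not_ge, if_pos hx1, zero_add, zero_add]
    have hz1 : 1 ≤ z := by nlinarith
    split_ifs with hxb
    · refine (mul_exp_add_mul_exp_le (w := c * w) hC₀.le hD0.le ?_ le_rfl).trans (by gcongr; linarith)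
      have h2 : c₂ ≤ c₀ * rate d x ^ 2 := by
        rw [hc₂]
        gcongr
        exact rate_one_le d hx1.le
      have h3 : w ≤ z := Real.rpow_le_self_of_one_le hz1 (by linarith)
      calc c * w ≤ c * (N * b) := by
            gcongr
            exact h3.trans (by rw [hz]; gcongr)
        _ = N * (c * b) := by ring
        _ ≤ N * (c₀ * rate d x ^ 2) := mul_le_mul_of_nonneg_left (by linarith) hN0.le
        _ = _ := by ring
    · rw [zero_add]
      gcongr
      linarith

theorem concentrates_power (d : ℕ) (hd : 1 ≤ d) {q η : ℝ} (hq : 4 < q) (hη : 0 < η)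
    (K : ℝ≥0) : Concentrates.{u} d (.power q η) K := by
  have hK0 : (0 : ℝ) ≤ K := K.2
  -- This makes the mean of the tail at most `x / 32`, as `exists_tail_power` requires.
  set b : ℝ := 32 * (1 + K) with hb
  have hb0 : 0 < b := by positivity
  obtain ⟨c₀, C₀, hc₀, hC₀, hmain⟩ := exists_quadCost_le_tail.{u} d hd (K := K) (b := b) hq hK0
    (by linarith)
  obtain ⟨Ct, hCt, htail⟩ := exists_tail_power.{u} (K := K) hq hK0
  have hr1 := rate_pos d one_pos
  set c₂ : ℝ := c₀ * rate d 1 ^ 2 with hc₂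
  have hc₂0 : 0 < c₂ := by positivity
  obtain ⟨B, hB0, hB⟩ := exists_one_add_rpow_le (p := q / 2) (α := 1) (δ := c₂) (by linarith)
    one_pos hc₂0
  set c : ℝ := min c₀ 1 with hc
  have hcpos : 0 < c := by positivity
  have l1 : c ≤ c₀ := min_le_left _ _
  have l2 : c ≤ 1 := min_le_right _ _
  set D : ℝ := C₀ * (B * b ^ (q / 2)) with hD
  have hD0 : 0 < D := by positivity
  have he := Real.exp_pos 1
  set C : ℝ := Real.exp 1 + C₀ + D + Ct with hC
  have hCpos : 0 < C := by positivity
  refine ⟨c, C, hcpos, hCpos, ?_⟩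
  intro Ω _ P _ N ξ μ _ hN h hmom x hx
  have hmom' : powerMoment q μ ≤ ENNReal.ofReal K :=
    hmom.trans_eq ENNReal.ofReal_coe_nnreal.symm
  rcases lt_or_ge (N * x ^ 2) 1 with hNx | hNx
  · exact (measureReal_le_of_mul_sq_lt_one _ d hN hx hNx l2 (by linarith)).trans
      (le_add_of_nonneg_right (boundB_nonneg c hCpos.le hx.le N _))
  obtain ⟨M, hM, hP⟩ := hmain Ω P N ξ μ hN h hmom' x hx
  have hN0 : (0 : ℝ) < N := by positivity
  have hN1 : (1 : ℝ) ≤ N := by exact_mod_cast hN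
  have ht := htail Ω P N ξ μ hN h hmom' x M hx hNx (by
    refine (lintegral_mono_ofReal_mul (by positivity) hM
      (lintegral_one_add_rpow_le hK0 hmom')).trans (ENNReal.ofReal_le_ofReal ?_)
    rw [div_mul_eq_mul_div, div_le_div_iff₀ hb0 (by norm_num), hb]
    linarith)
  refine (hP.trans (add_le_add le_rfl ht)).trans ?_
  rw [boundB_two_power]
  set z : ℝ := N * x with hz
  have hz0 : 0 < z := by positivity
  have hz1 : 1 ≤ z := by
    rcases le_or_gt x 1 with hx1 | hx1 <;> nlinarith
  have hzη : z ^ (-(q / 2)) ≤ z ^ (-((q - η) / 2)) :=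
    Real.rpow_le_rpow_of_exponent_le hz1 (by linarith)
  rcases le_or_gt x 1 with hx1 | hx1
  · rw [if_pos (by linarith : x ≤ b), if_pos hx1]
    gcongr
    · linarith
    · linarith
  · rw [if_neg hx1.not_ge, zero_add]
    have h1 : (if x ≤ b then C₀ * Real.exp (-(c₀ * N * rate d x ^ 2)) else 0) ≤
        D * (N * z ^ (-(q / 2))) := by
      split_ifs with hxb
      · have h2 : c₂ ≤ c₀ * rate d x ^ 2 := by
          rw [hc₂]
          gcongr
          exact rate_one_le d hx1.le
        have h3 : Real.exp (-(c₀ * N * rate d x ^ 2)) ≤ Real.exp (-(c₂ * N)) := by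
          refine Real.exp_le_exp.2 (neg_le_neg ?_)
          calc c₂ * N ≤ c₀ * rate d x ^ 2 * N := by gcongr
            _ = _ := by ring
        -- For `1 < x ≤ b` the shell term is exponentially small in `N`, and `z = N x` is comparable
        -- to `N`, so the power bound absorbs it.
        have h4 : Real.exp (-(c₂ * N)) * (N : ℝ) ^ (q / 2) ≤ B := by
          have h5 := hB N hN0.le
          rw [Real.rpow_one] at h5
          rw [Real.exp_neg, inv_mul_le_iff₀ (Real.exp_pos _)]
          linarith
        have h6 : 1 ≤ (N : ℝ) ^ (q / 2) * b ^ (q / 2) * z ^ (-(q / 2)) := by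
          rw [← Real.mul_rpow hN0.le hb0.le, Real.rpow_neg hz0.le, ← div_eq_mul_inv,
            one_le_div (by positivity)]
          exact Real.rpow_le_rpow hz0.le (by rw [hz]; gcongr) (by linarith)
        have h7 : 0 ≤ z ^ (-(q / 2)) := by positivity
        calc _ ≤ C₀ * Real.exp (-(c₂ * N)) * 1 := by rw [mul_one]; gcongr
          _ ≤ C₀ * Real.exp (-(c₂ * N)) * ((N : ℝ) ^ (q / 2) * b ^ (q / 2) * z ^ (-(q / 2))) := by
            gcongr
          _ = C₀ * ((Real.exp (-(c₂ * N)) * (N : ℝ) ^ (q / 2)) * b ^ (q / 2)) * z ^ (-(q / 2)) := by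
            ring
          _ ≤ D * (1 * z ^ (-(q / 2))) := by
            rw [one_mul, hD]
            gcongr
          _ ≤ _ := by gcongr
      · positivity
    calc _ ≤ D * (N * z ^ (-(q / 2))) + Ct * (N * z ^ (-(q / 2))) := add_le_add h1 le_rfl
      _ = (D + Ct) * (N * z ^ (-(q / 2))) := by ring
      _ ≤ C * (N * z ^ (-((q - η) / 2))) := by
        gcongr
        linarith

theorem concentrates (d : ℕ) (hd : 1 ≤ d) (T : MomentCondition) (hT : T.Valid) (K : ℝ≥0) :
    Concentrates.{u} d T K := by
  cases T with
  | expHigh α γ => exact concentrates_expHigh d hd hT.1 hT.2 K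
  | expLow α γ η => exact concentrates_expLow d hd hT.1 hT.2.1 hT.2.2.1 hT.2.2.2.1 K
  | power q η => exact concentrates_power d hd hT.1 hT.2.1 K

/-- Almost surely, the relaxed Wasserstein divergence of a sample is controlled by the quadratic
transport cost. -/
theorem IsSample.rwDivergence_real_le {d n : ℕ} {Ω : Type*} [MeasurableSpace Ω] {P : Measure Ω}
    [IsProbabilityMeasure P] {ξ : Fin n → Ω → Space d} {μ : Measure (Space d)}
    (h : IsSample P ξ μ) {dom X : Set (Space d)} {φ : Space d → ℝ} {L : ℝ} (hL : 0 < L)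
    (hφ : IsSmoothStrictlyConvex dom φ L) (hX : MeasurableSet X) (hXdom : X ⊆ dom)
    (hμ : μ Xᶜ = 0) {ε : ℝ} :
    P.real {ω | ENNReal.ofReal ε ≤ rwDivergence dom φ (empiricalMeasure fun i => ξ i ω) μ} ≤
      P.real {ω | ENNReal.ofReal (2 * ε / L) ≤ quadCost (empiricalMeasure fun i => ξ i ω) μ} := by
  -- Only off this null event does the empirical measure live on `X`, as the comparison of the costs
  -- requires.
  have hnull : P.real {ω | ∃ i, ξ i ω ∈ Xᶜ} ≤ 0 := by
    refine (h.real_exists_mem_le hX.compl).trans_eq ?_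
    simp [Measure.real, hμ]
  have hsub : {ω | ENNReal.ofReal ε ≤ rwDivergence dom φ (empiricalMeasure fun i => ξ i ω) μ} ⊆
      {ω | ENNReal.ofReal (2 * ε / L) ≤ quadCost (empiricalMeasure fun i => ξ i ω) μ} ∪
        {ω | ∃ i, ξ i ω ∈ Xᶜ} := by
    intro ω hω
    by_cases hex : ∃ i, ξ i ω ∈ Xᶜ
    · exact Or.inr hex
    · left
      push Not at hex
      have hemp : empiricalMeasure (fun i => ξ i ω) Xᶜ = 0 := by
        rw [empiricalMeasure_apply _ hX.compl, Finset.sum_eq_zero fun i _ =>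
          Set.indicator_of_notMem (hex i) _, mul_zero]
      have h1 := (show ENNReal.ofReal ε ≤ _ from hω).trans
        (rwDivergence_le hL hφ hX hXdom hemp hμ)
      have e : ε = L / 2 * (2 * ε / L) := by field_simp
      rw [e, ENNReal.ofReal_mul (half_pos hL).le] at h1
      exact (ENNReal.mul_le_mul_iff_right (by simpa using hL) ENNReal.ofReal_ne_top).1 h1
  linarith [(measureReal_mono hsub (measure_ne_top P _)).trans (measureReal_union_le _ _)]

end RelaxedWasserstein

theorem mainTheorem3 (d : ℕ) (hd : 1 ≤ d)
    (T : RelaxedWasserstein.MomentCondition) (hT : T.Valid) (K : ℝ≥0) :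
    ∃ c C₁ C₂ : ℝ, 0 < c ∧ 0 < C₁ ∧ 0 < C₂ ∧
      ∀ (dom X : Set (RelaxedWasserstein.Space d)) (φ : RelaxedWasserstein.Space d → ℝ) (L : ℝ),
        0 < L → RelaxedWasserstein.IsSmoothStrictlyConvex dom φ L →
        MeasurableSet X → X ⊆ dom →
      ∀ (Pr : Measure (RelaxedWasserstein.Space d)) [IsProbabilityMeasure Pr],
        Pr Xᶜ = 0 → T.moment Pr ≤ K →
      ∀ (Ω : Type*) [MeasurableSpace Ω] (P : Measure Ω) [IsProbabilityMeasure P]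
        (n : ℕ) (ξ : Fin n → Ω → RelaxedWasserstein.Space d),
        1 ≤ n → (∀ i, Measurable (ξ i)) → iIndepFun ξ P → (∀ i, P.map (ξ i) = Pr) →
      ∀ ε : ℝ, 0 < ε →
        P.real {ω | ENNReal.ofReal ε ≤ RelaxedWasserstein.rwDivergence dom φ
            (RelaxedWasserstein.empiricalMeasure fun i => ξ i ω) Pr} ≤
          (if ε ≤ L / 2 then RelaxedWasserstein.boundA d c C₁ L n ε else 0) +
            RelaxedWasserstein.boundB c C₂ L n ε T := by
  open RelaxedWasserstein in
  obtain ⟨c, C, hc, hC, hmain⟩ := concentrates d hd T hT K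
  have h2d : (1 : ℝ) ≤ 2 ^ d := one_le_pow₀ one_le_two
  have hcc : c / (16 * 2 ^ d) ≤ c := div_le_self hc.le (by linarith)
  -- The divisor is the factor of `le_boundA`. A smaller `c` only enlarges `boundB`.
  refine ⟨c / (16 * 2 ^ d), C, C, by positivity, hC, hC, ?_⟩
  intro dom X φ L hL hφ hX hXdom Pr _ hPr hmom Ω _ P _ n ξ hn hξm hξi hξl ε hε
  have hs : RelaxedWasserstein.IsSample P ξ Pr := ⟨hξm, hξi, hξl⟩
  have hx : 0 < 2 * ε / L := by positivity
  refine (hs.rwDivergence_real_le hL hφ hX hXdom hPr).trans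
    ((hmain Ω P n ξ Pr hn hs hmom _ hx).trans ?_)
  rw [RelaxedWasserstein.boundB_eq _ C hL n ε T]
  refine add_le_add ?_ (RelaxedWasserstein.boundB_anti hcc hC.le hx.le n T)
  have hiff : 2 * ε / L ≤ 1 ↔ ε ≤ L / 2 := by
    rw [div_le_one hL, le_div_iff₀ two_pos, mul_comm]
  simp only [hiff]
  split_ifs
  · refine le_trans (le_of_eq ?_)
      (RelaxedWasserstein.le_boundA d (by positivity) hC.le hL n hε)
    congr 4
    field_simp
  · exact le_rfl
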